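/- Let $M$ be a $d$-dimensional closed (compact, boundaryless) Riemannian manifold and let $\mathrm{End}^1(M)$ be the set of $C^1$ maps $M\to M$ with the $C^1$ topology. Fix an integer $1\le\kappa<d$. For $f\in\mathrm{End}^1(M)$ let $m_f$ be the smallest $m\ge 1$ such that $\{x\in M:\dim\ker(Df^m_x)=\kappa\}$ has nonempty interior or, if there is no such $m$, the smallest $m\ge1$ for which this set is nonempty; put $\mathrm{Cr}_\kappa(f)=\{x\in M:\dim\ker(Df^{m_f}_x)=\kappa\}$ (empty if there is no $m$ at all). Let $\Lambda_f$ be the set of sequences $(x_i)_{i\in\mathbb Z}$ in $M$ with $f(x_i)=x_{i+1}$ for all $i$ such that $x_i\in\mathrm{Cr}_\kappa(f)$ for infinitely many $i<0$ and for infinitely many $i>0$. For $(x_i)_i\in\Lambda_f$ and $i\in\mathbb Z$ put $$E(x_i)=\ker\bigl(Df^{\,m_f+\tau_i^+}_{x_i}\bigr),\qquad F(x_i)=\mathrm{Im}\bigl(Df^{\,|\tau_i^-|}_{x_{i+\tau_i^-}}\bigr),$$ where $\tau_i^+=\min\{n\ge0:x_{i+n}\in\mathrm{Cr}_\kappa(f)\}$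 and $\tau_i^-=\max\{n\le-m_f:x_{i+n}\in\mathrm{Cr}_\kappa(f)\}$. For $\alpha>0$ and an integer $\ell\ge1$, the splitting $E\oplus F$ is called an $(\alpha,\ell)$-dominated splitting (of index $\kappa$) over $\Lambda_f$ if $\Lambda_f$ is shift-invariant and for every $(x_i)_i\in\Lambda_f$ and $i\in\mathbb Z$: $\dim E(x_i)=\kappa$, $\dim F(x_i)=d-\kappa$, $T_{x_i}M=E(x_i)\oplus F(x_i)$, $Df(E(x_i))\subseteq E(x_{i+1})$, $Df(F(x_i))=F(x_{i+1})$, the angle between $E(x_i)$ and $F(x_i)$ is at least $\alpha$, and $\|Df^\ell(u)\|\le\frac12\|Df^\ell(v)\|$ for all unit vectors $u\in E(x_i)$, $v\in F(x_i)$. Theorem B. Let $f_0\in\mathrm{End}^1(M)$ have a critical point, i.e. a point at which $Df_0$ is not an isomorphism. Let $\mathcal F\subseteq\mathrm{End}^1(M)$ be a set accumulating at $f_0$ (that is, $f_0\in\overline{\mathcal F}$) such that every $f\in\mathcal F$ satisfies $\Lambda_f\ne\emptyset$ and $\dim\ker(Df^m_x)\le\kappa$ for all $m\ge1$ and $x\in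 M$. Then at least one of the following holds: (1) there are a neighbourhood $\mathcal U$ of $f_0$, an integer $\ell\ge1$ and a number $\alpha>0$ such that for every $f\in\mathcal F\cap\mathcal U$ the splitting $E\oplus F$ is an $(\alpha,\ell)$-dominated splitting over $\Lambda_f$; (2) $f_0$ is accumulated by endomorphisms $g$ having a larger kernel, i.e. every neighbourhood of $f_0$ contains some $g$ with $\dim\ker(Dg^m_x)>\kappa$ for some $m\ge1$ and $x\in M$. -/

import Mathlib

open scoped Manifold ContDiff Bundle Topology

noncomputable section

namespace EndoDom

/-- The space `End¹(M)` of `C¹` self-maps (endomorphisms) of the `d`-dimensional manifold `M`. -/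
abbrev End1 (d : ℕ) (M : Type*) [TopologicalSpace M]
    [ChartedSpace (EuclideanSpace ℝ (Fin d)) M] [IsManifold (𝓡 d) ∞ M] : Type _ :=
  ContMDiffMap (𝓡 d) (𝓡 d) M M 1

section

variable {d : ℕ} {M : Type*} [TopologicalSpace M]
  [ChartedSpace (EuclideanSpace ℝ (Fin d)) M] [IsManifold (𝓡 d) ∞ M]

/-- The tangent map `Tf : TM → TM` of a `C¹` map, as a continuous map. -/
def tangentLift (f : End1 d M) :
    C(TangentBundle (𝓡 d) M, TangentBundle (𝓡 d) M) :=
  ⟨tangentMap (𝓡 d) (𝓡 d) f, f.contMDiff.continuous_tangentMap le_rfl⟩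

/-- The `C¹` topology on `End¹(M)`: the topology of uniform convergence on compact sets
of the tangent maps, i.e. the one induced by `f ↦ Tf` from the compact-open topology. -/
instance c1Topology : TopologicalSpace (End1 d M) :=
  TopologicalSpace.induced tangentLift inferInstance

/-- `D(f^m)_x`, the derivative of the `m`-th iterate of `f` at `x`. -/
def iterDeriv (f : End1 d M) (m : ℕ) (x : M) :
    TangentSpace (𝓡 d) x →L[ℝ] TangentSpace (𝓡 d) ((⇑f)^[m] x) :=
  mfderiv (𝓡 d) (𝓡 d) ((⇑f)^[m]) x

/-- `dim ker D(f^m)_x`. -/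
def kerDim (f : End1 d M) (m : ℕ) (x : M) : ℕ :=
  Module.finrank ℝ (LinearMap.ker (iterDeriv f m x).toLinearMap)

/-- `x` is a critical point of `f`: the derivative at `x` is not a linear isomorphism. -/
def IsCritical (f : End1 d M) (x : M) : Prop :=
  ¬ Function.Bijective (mfderiv (𝓡 d) (𝓡 d) f x)

/-- The set of points where `D(f^m)` has kernel of dimension exactly `κ`. -/
def kerLocus (κ : ℕ) (f : End1 d M) (m : ℕ) : Set M := {x | kerDim f m x = κ}

open Classical in
/-- `m_f`: the smallest `m ≥ 1` for which `{x | dim ker D(f^m)_x = κ}` has nonempty interior, if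
there is such an `m`; otherwise the smallest `m ≥ 1` for which this set is nonempty.
(If there is none either, the value is `0`, and for `κ ≥ 1` the sets `crit κ f` and
`Lam κ f` below are then empty.) -/
def order (κ : ℕ) (f : End1 d M) : ℕ :=
  if ∃ m, 1 ≤ m ∧ (interior (kerLocus κ f m)).Nonempty then
    sInf {m | 1 ≤ m ∧ (interior (kerLocus κ f m)).Nonempty}
  else sInf {m | 1 ≤ m ∧ (kerLocus κ f m).Nonempty}

/-- `Cr_κ(f) = {x | dim ker D(f^{m_f})_x = κ}`. -/
def crit (κ : ℕ) (f : End1 d M) : Set M := kerLocus κ f (order κ f)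

/-- The inverse limit space `M_f`: the set of full (two-sided) orbits of `f`. -/
def orbits (f : End1 d M) : Set (ℤ → M) := {x | ∀ i, f (x i) = x (i + 1)}

/-- `Λ_f`: the full orbits which visit `Cr_κ(f)` infinitely often in the past and in the future. -/
def Lam (κ : ℕ) (f : End1 d M) : Set (ℤ → M) :=
  {x | x ∈ orbits f ∧ {i : ℤ | i < 0 ∧ x i ∈ crit κ f}.Infinite ∧
    {i : ℤ | 0 < i ∧ x i ∈ crit κ f}.Infinite}

/-- `τ⁺_i = min {n ≥ 0 | x_{i+n} ∈ Cr_κ(f)}`. -/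
def tauPlus (κ : ℕ) (f : End1 d M) (x : ℤ → M) (i : ℤ) : ℕ :=
  sInf {n : ℕ | x (i + n) ∈ crit κ f}

/-- `|τ⁻_i|`, where `τ⁻_i = max {n ≤ -m_f | x_{i+n} ∈ Cr_κ(f)}`. -/
def absTauMinus (κ : ℕ) (f : End1 d M) (x : ℤ → M) (i : ℤ) : ℕ :=
  sInf {n : ℕ | order κ f ≤ n ∧ x (i - n) ∈ crit κ f}

/-- `E(x_i) = ker D(f^{m_f + τ⁺_i})_{x_i}`. -/
def kerBundle (κ : ℕ) (f : End1 d M) (x : ℤ → M) (i : ℤ) :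
    Submodule ℝ (TangentSpace (𝓡 d) (x i)) :=
  LinearMap.ker (iterDeriv f (order κ f + tauPlus κ f x i) (x i)).toLinearMap

/-- `F(x_i) = Im D(f^{|τ⁻_i|})_{x_{i+τ⁻_i}}`. For an orbit the image lies in the tangent space at
`f^{|τ⁻_i|}(x_{i+τ⁻_i}) = x_i`; all tangent spaces are copies of the model space read in the
preferred chart of the base point, so equal base points give literally the same space. -/
def imBundle (κ : ℕ) (f : End1 d M) (x : ℤ → M) (i : ℤ) :
    Submodule ℝ (TangentSpace (𝓡 d) (x i)) :=
  LinearMap.range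
    (iterDeriv f (absTauMinus κ f x i) (x (i - absTauMinus κ f x i))).toLinearMap

/-- The families `E`, `F` of subspaces along the orbits in `L` form an `(α, ℓ)`-dominated
splitting of index `κ` for `f` over the invariant set `L ⊆ M_f`.
(For an orbit, `f (x i) = x (i + 1)`, so that `Df_{x_i}` takes values in the tangent
space at `x (i + 1)`.) -/
structure IsDominatedSplitting [Bundle.RiemannianBundle (fun x : M ↦ TangentSpace (𝓡 d) x)]
    (κ : ℕ) (f : End1 d M) (L : Set (ℤ → M))
    (E F : ∀ (x : ℤ → M) (i : ℤ), Submodule ℝ (TangentSpace (𝓡 d) (x i)))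
    (α : ℝ) (ℓ : ℕ) : Prop where
  subset_orbits : L ⊆ orbits f
  invariant : (fun (x : ℤ → M) (i : ℤ) ↦ x (i + 1)) ⁻¹' L = L
  finrank_E : ∀ x ∈ L, ∀ i, Module.finrank ℝ (E x i) = κ
  finrank_F : ∀ x ∈ L, ∀ i, Module.finrank ℝ (F x i) = d - κ
  isCompl : ∀ x ∈ L, ∀ i, IsCompl (E x i) (F x i)
  map_E : ∀ x ∈ L, ∀ i, ∀ u ∈ E x i, mfderiv (𝓡 d) (𝓡 d) f (x i) u ∈ E x (i + 1)
  map_F : ∀ x ∈ L, ∀ i,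
    (F x i).map (mfderiv (𝓡 d) (𝓡 d) f (x i)).toLinearMap = F x (i + 1)
  angle_pos : 0 < α
  angle_le : ∀ x ∈ L, ∀ i, ∀ u ∈ E x i, ∀ v ∈ F x i, u ≠ 0 → v ≠ 0 →
    α ≤ InnerProductGeometry.angle u v
  one_le : 1 ≤ ℓ
  dominated : ∀ x ∈ L, ∀ i, ∀ u ∈ E x i, ∀ v ∈ F x i, ‖u‖ = 1 → ‖v‖ = 1 →
    ‖iterDeriv f ℓ (x i) u‖ ≤ 1 / 2 * ‖iterDeriv f ℓ (x i) v‖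

end

end EndoDom

end

/-!
If `f₀` is not accumulated by maps having a larger kernel, then all maps in some neighbourhood of
`f₀` have kernels of dimension at most `κ`, along all orbit segments. By Franks' lemma this
persists at the level of linear cocycles: for some `ε > 0` and all `f ∈ 𝓕` close to `f₀`, even the
`ε`-perturbations of the derivative cocycle of `f` along a finite orbit segment have kernels of
dimension at most `κ` (`EndoDom.KernelRobust`). The rest of the argument is linear algebra along the
orbits in `Λ_f`, with constants that depend only on `ε` and on a bound `K` of the derivatives.

*Franks' lemma.* `EndoDom.exists_franks` realizes small perturbations of the derivatives at finitely
many different points. An orbit segment may be periodic, so a given sequence of perturbed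
derivatives need not be a function of the point. `EndoDom.exists_franks_orbit` removes this obstacle
by moving the segment: once the derivatives of the iterates at `x` are pairwise different, which
is achieved by a preliminary rescaling of the derivative, some points close to `x` have pairwise
different iterates (`EndoDom.frequently_injOn_iterate`). The rescaling works because no iterate has
derivative zero, which is where `κ < d` enters.

*The subspaces.* Because kernels have dimension at most `κ`, and `κ` is reached infinitely often in
the past and in the future of an orbit in `Λ_f`, the subspace `E` is the eventual kernel
of the derivative cocycle and `F` its eventual image (`EndoDom.exists_Eb_eq`,
`EndoDom.exists_Fb_eq`). They are invariant, complementary, and of the right dimension. The exact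
value of `m_f` plays no role in this.

*Domination.* Consider a pseudo-orbit of vectors `w 0, …, w n` with errors at most `ε * ‖w j‖`,
leading from `F` to `E`. Rank one corrections of the derivatives turn it into an orbit of a
perturbed cocycle. A preimage of `w 0` far in the past is then sent to zero in the future, in addition to the
`κ`-dimensional kernel, which contradicts robustness (`EndoDom.not_pseudoOrbit`). If `F` made a
small angle with `E`, or if vectors of `E` were not dominated by vectors of `F` after many iterations,
such a pseudo-orbit could be written down: for the domination, a multiple of the orbit of a vector
of `E`, growing by a factor `1 + s` at each step, is added to the orbit of a vector of `F`
(`EndoDom.mul_nrm_right_le_nrm_add`, `EndoDom.nrm_iterD_le`).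
-/

set_option linter.unusedSectionVars false

namespace EndoDom

noncomputable section

open Set Filter

variable {d : ℕ} {M : Type*} [TopologicalSpace M]
  [ChartedSpace (EuclideanSpace ℝ (Fin d)) M] [IsManifold (𝓡 d) ∞ M]

/-! ### The Riemannian metric on the model space -/

section RiemannianNorm

variable [Bundle.RiemannianBundle (fun x : M ↦ TangentSpace (𝓡 d) x)]

/-- The Riemannian norm at `x` of a vector of the model space, seen as a tangent vector at `x`.
All tangent spaces are definitionally the model space, and only the base point selects the norm;
making it an explicit argument allows vectors at different points to be compared. -/
def nrm (x : M) (v : EuclideanSpace ℝ (Fin d)) : ℝ := norm (E := TangentSpace (𝓡 d) x) v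

lemma nrm_add (x : M) (v w : EuclideanSpace ℝ (Fin d)) : nrm x (v + w) ≤ nrm x v + nrm x w :=
  norm_add_le (E := TangentSpace (𝓡 d) x) v w

lemma nrm_sub (x : M) (v w : EuclideanSpace ℝ (Fin d)) : nrm x (v - w) ≤ nrm x v + nrm x w :=
  norm_sub_le (E := TangentSpace (𝓡 d) x) v w

lemma nrm_neg (x : M) (v : EuclideanSpace ℝ (Fin d)) : nrm x (-v) = nrm x v :=
  norm_neg (E := TangentSpace (𝓡 d) x) v

lemma nrm_smul (x : M) (c : ℝ) (w : EuclideanSpace ℝ (Fin d)) :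
    nrm x (c • w) = |c| * nrm x w :=
  norm_smul (β := TangentSpace (𝓡 d) x) c w

lemma nrm_nonneg (x : M) (v : EuclideanSpace ℝ (Fin d)) : 0 ≤ nrm x v :=
  norm_nonneg (E := TangentSpace (𝓡 d) x) v

lemma nrm_zero (x : M) : nrm x (0 : EuclideanSpace ℝ (Fin d)) = 0 :=
  norm_zero (E := TangentSpace (𝓡 d) x)

lemma nrm_pos (x : M) {v : EuclideanSpace ℝ (Fin d)} (hv : v ≠ 0) : 0 < nrm x v :=
  norm_pos_iff (E := TangentSpace (𝓡 d) x).2 hv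

lemma continuous_nrm_apply (x : M) : Continuous (nrm (d := d) x) :=
  continuous_norm (E := TangentSpace (𝓡 d) x)

/-- The Riemannian inner product at `x`, as a bounded bilinear form on the model space. -/
def ip (x : M) : EuclideanSpace ℝ (Fin d) →L[ℝ] EuclideanSpace ℝ (Fin d) →L[ℝ] ℝ :=
  (innerSL ℝ (E := TangentSpace (𝓡 d) x) : TangentSpace (𝓡 d) x →L[ℝ] TangentSpace (𝓡 d) x →L[ℝ] ℝ)

lemma ip_self (x : M) (v : EuclideanSpace ℝ (Fin d)) : ip x v v = nrm x v ^ 2 :=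
  real_inner_self_eq_norm_sq (F := TangentSpace (𝓡 d) x) v

lemma abs_ip_le (x : M) (v w : EuclideanSpace ℝ (Fin d)) : |ip x v w| ≤ nrm x v * nrm x w :=
  abs_real_inner_le_norm (F := TangentSpace (𝓡 d) x) v w

lemma ip_comm (x : M) (v w : EuclideanSpace ℝ (Fin d)) : ip x v w = ip x w v :=
  real_inner_comm (F := TangentSpace (𝓡 d) x) w v

end RiemannianNorm

/-! ### Derivatives of iterates -/

section DerivativeCocycle

/-- The derivative of a map at `x`, as an endomorphism of the model space. -/
def D (f : End1 d M) (x : M) : EuclideanSpace ℝ (Fin d) →L[ℝ] EuclideanSpace ℝ (Fin d) :=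
  mfderiv (𝓡 d) (𝓡 d) f x

lemma mdifferentiable (f : End1 d M) : MDifferentiable (𝓡 d) (𝓡 d) f :=
  f.contMDiff.mdifferentiable one_ne_zero

lemma mdifferentiable_iterate (f : End1 d M) (n : ℕ) : MDifferentiable (𝓡 d) (𝓡 d) (⇑f)^[n] := by
  induction n with
  | zero => exact mdifferentiable_id
  | succ n ih => exact ih.comp (mdifferentiable f)

/-- The derivative of the `n`-th iterate at `x`, as an endomorphism of the model space. -/
def iterD (f : End1 d M) (n : ℕ) (x : M) :
    EuclideanSpace ℝ (Fin d) →L[ℝ] EuclideanSpace ℝ (Fin d) :=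
  iterDeriv f n x

lemma iterD_zero (f : End1 d M) (x : M) : iterD f 0 x = .id ℝ _ := mfderiv_id

lemma iterD_one (f : End1 d M) (x : M) : iterD f 1 x = D f x := rfl

lemma iterD_add (f : End1 d M) (m n : ℕ) (x : M) :
    iterD f (m + n) x = (iterD f m ((⇑f)^[n] x)).comp (iterD f n x) := by
  unfold iterD iterDeriv
  rw [Function.iterate_add]
  exact mfderiv_comp x (mdifferentiable_iterate f m _) (mdifferentiable_iterate f n x)

lemma iterD_succ (f : End1 d M) (n : ℕ) (x : M) :
    iterD f (n + 1) x = (D f ((⇑f)^[n] x)).comp (iterD f n x) := by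
  rw [add_comm, iterD_add, iterD_one]

/-- The composition `B (n - 1) ∘ ⋯ ∘ B 0`, the identity if `n = 0`. -/
def cprod (B : ℕ → EuclideanSpace ℝ (Fin d) →L[ℝ] EuclideanSpace ℝ (Fin d)) :
    ℕ → EuclideanSpace ℝ (Fin d) →L[ℝ] EuclideanSpace ℝ (Fin d)
  | 0 => .id ℝ _
  | n + 1 => (B n).comp (cprod B n)

lemma iterD_eq_cprod (f : End1 d M) (n : ℕ) (x : M) :
    iterD f n x = cprod (fun j ↦ D f ((⇑f)^[j] x)) n := by
  induction n with
  | zero => exact iterD_zero f x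
  | succ n ih => rw [iterD_succ, ih]; rfl

lemma cprod_congr {B B' : ℕ → EuclideanSpace ℝ (Fin d) →L[ℝ] EuclideanSpace ℝ (Fin d)} {n : ℕ}
    (h : ∀ j < n, B j = B' j) : cprod B n = cprod B' n := by
  induction n with
  | zero => rfl
  | succ n ih =>
    rw [cprod, cprod, ih fun j hj ↦ h j (by omega), h n (by omega)]

lemma cprod_add (B : ℕ → EuclideanSpace ℝ (Fin d) →L[ℝ] EuclideanSpace ℝ (Fin d)) (m n : ℕ) :
    cprod B (m + n) = (cprod (fun j ↦ B (m + j)) n).comp (cprod B m) := by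
  induction n with
  | zero => rfl
  | succ n ih => rw [← add_assoc, cprod, ih]; rfl

end DerivativeCocycle

/-! ### Points of the tangent bundle -/

section Vectors

/-- The vector `v` of the model space, as a tangent vector at `x`. -/
def tv (x : M) (v : EuclideanSpace ℝ (Fin d)) : TangentBundle (𝓡 d) M := ⟨x, v⟩

/-- The vector part of a tangent vector, as a vector of the model space. -/
def vec (w : TangentBundle (𝓡 d) M) : EuclideanSpace ℝ (Fin d) := w.2

@[simp] lemma tv_proj (x : M) (v : EuclideanSpace ℝ (Fin d)) : (tv x v).1 = x := rfl

@[simp] lemma vec_tv (x : M) (v : EuclideanSpace ℝ (Fin d)) : vec (tv x v) = v := rfl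

@[simp] lemma tv_vec (w : TangentBundle (𝓡 d) M) : tv w.1 (vec w) = w := rfl

lemma exists_eq_tv {w : TangentBundle (𝓡 d) M} {p : M} (h : w.1 = p) :
    ∃ v : EuclideanSpace ℝ (Fin d), w = tv p v := by
  subst h
  exact ⟨vec w, rfl⟩

lemma tangentLift_apply (f : End1 d M) (w : TangentBundle (𝓡 d) M) :
    tangentLift f w = tv (f w.1) (D f w.1 (vec w)) := rfl

lemma continuous_proj : Continuous fun w : TangentBundle (𝓡 d) M ↦ w.1 :=
  FiberBundle.continuous_proj (EuclideanSpace ℝ (Fin d)) _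

end Vectors

section Continuity

variable [Bundle.RiemannianBundle (fun x : M ↦ TangentSpace (𝓡 d) x)]
  [IsContMDiffRiemannianBundle (𝓡 d) ∞ (EuclideanSpace ℝ (Fin d))
      (fun x : M ↦ TangentSpace (𝓡 d) x)]

instance isContinuousRiemannianBundle : IsContinuousRiemannianBundle (EuclideanSpace ℝ (Fin d))
    (fun x : M ↦ TangentSpace (𝓡 d) x) := by
  obtain ⟨g, hg, h⟩ := IsContMDiffRiemannianBundle.exists_contMDiff (IB := 𝓡 d) (n := ∞)
    (F := EuclideanSpace ℝ (Fin d)) (E := fun x : M ↦ TangentSpace (𝓡 d) x)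
  exact ⟨g, hg.continuous, h⟩

lemma continuous_nrm : Continuous fun v : TangentBundle (𝓡 d) M ↦ nrm v.1 (vec v) := by
  have h := Continuous.inner_bundle (F := EuclideanSpace ℝ (Fin d))
    (E := fun x : M ↦ TangentSpace (𝓡 d) x) (M := TangentBundle (𝓡 d) M) (b := fun v ↦ v.1)
    (v := fun v ↦ v.2) (w := fun v ↦ v.2) continuous_id continuous_id
  refine (Real.continuous_sqrt.comp h).congr fun v ↦ ?_
  exact (norm_eq_sqrt_real_inner (F := TangentSpace (𝓡 d) v.1) v.2).symm

lemma continuousAt_nrm {X : Type*} [TopologicalSpace X] {a : X → M}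
    {b : X → EuclideanSpace ℝ (Fin d)} {t : X} (h : ContinuousAt (fun s ↦ tv (a s) (b s)) t) :
    ContinuousAt (fun s ↦ nrm (a s) (b s)) t :=
  ContinuousAt.comp (g := fun w : TangentBundle (𝓡 d) M ↦ nrm w.1 (vec w))
    continuous_nrm.continuousAt h

lemma exists_nrm_le_of_isCompact {K : Set (TangentBundle (𝓡 d) M)} (hK : IsCompact K) :
    ∃ R, 0 < R ∧ ∀ v ∈ K, nrm v.1 (vec v) ≤ R := by
  obtain ⟨R, hR⟩ := hK.bddAbove_image (continuous_nrm (d := d) (M := M)).continuousOn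
  refine ⟨max R 1, by positivity, fun v hv ↦ le_max_of_le_left (hR ⟨v, hv, rfl⟩)⟩

end Continuity

/-! ### Trivializations of the tangent bundle -/

section Trivialization

/-- The trivialization of `TM` centred at `p`, on the fibre over `y`; this is the derivative at
`y` of the preferred chart at `p`. -/
def C (p y : M) : EuclideanSpace ℝ (Fin d) →L[ℝ] EuclideanSpace ℝ (Fin d) :=
  (trivializationAt (EuclideanSpace ℝ (Fin d)) (fun x : M ↦ TangentSpace (𝓡 d) x)
    p).continuousLinearMapAt ℝ y

/-- The inverse of the trivialization `C p y`, for `y` in the domain of the chart at `p`. -/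
def Cinv (p y : M) : EuclideanSpace ℝ (Fin d) →L[ℝ] EuclideanSpace ℝ (Fin d) :=
  (trivializationAt (EuclideanSpace ℝ (Fin d)) (fun x : M ↦ TangentSpace (𝓡 d) x) p).symmL ℝ y

/-- The domain of the preferred chart at `p`. -/
abbrev src (p : M) : Set M := (chartAt (EuclideanSpace ℝ (Fin d)) p).source

lemma isOpen_src (p : M) : IsOpen (src (d := d) p) :=
  (chartAt (EuclideanSpace ℝ (Fin d)) p).open_source

lemma mem_src (p : M) : p ∈ src (d := d) p := mem_chart_source _ p

lemma src_mem_nhds (p : M) : src (d := d) p ∈ 𝓝 p := (isOpen_src p).mem_nhds (mem_src p)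

lemma C_eq_mfderiv {p y : M} (hy : y ∈ src (d := d) p) :
    C (d := d) p y = mfderiv (𝓡 d) 𝓘(ℝ, EuclideanSpace ℝ (Fin d)) (extChartAt (𝓡 d) p) y :=
  TangentBundle.continuousLinearMapAt_trivializationAt hy

lemma Cinv_C {p y : M} (hy : y ∈ src (d := d) p) (v : EuclideanSpace ℝ (Fin d)) :
    Cinv p y (C p y v) = v :=
  (trivializationAt (EuclideanSpace ℝ (Fin d)) (fun x : M ↦ TangentSpace (𝓡 d) x)
    p).symmL_continuousLinearMapAt (R := ℝ) hy v

lemma C_Cinv {p y : M} (hy : y ∈ src (d := d) p) (v : EuclideanSpace ℝ (Fin d)) :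
    C p y (Cinv p y v) = v :=
  (trivializationAt (EuclideanSpace ℝ (Fin d)) (fun x : M ↦ TangentSpace (𝓡 d) x)
    p).continuousLinearMapAt_symmL (R := ℝ) hy v

/-- The preferred chart at `p` has derivative the identity at `p`, by the way the tangent spaces
are identified with the model space. -/
lemma C_self (p : M) (v : EuclideanSpace ℝ (Fin d)) : C p p v = v := by
  rw [C_eq_mfderiv (mem_src p), mfderiv_extChartAt_self]
  rfl

lemma Cinv_self (p : M) (v : EuclideanSpace ℝ (Fin d)) : Cinv p p v = v := by
  conv_lhs => rw [← C_self p v]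
  exact Cinv_C (mem_src p) v

/-- The trivialization of `TM` centred at `p` is a diffeomorphism over the domain of the chart,
so its fibre component is continuous there. -/
lemma continuousOn_C (p : M) :
    ContinuousOn (fun v : TangentBundle (𝓡 d) M ↦ C p v.1 (vec v)) {v | v.1 ∈ src (d := d) p} := by
  have h := (trivializationAt (EuclideanSpace ℝ (Fin d))
    (fun x : M ↦ TangentSpace (𝓡 d) x) p).continuousOn
  refine (continuous_snd.comp_continuousOn h).congr fun v hv ↦ ?_
  exact (trivializationAt (EuclideanSpace ℝ (Fin d))
    (fun x : M ↦ TangentSpace (𝓡 d) x) p).continuousLinearMapAt_apply_of_mem (R := ℝ) hv v.2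

lemma continuousOn_Cinv (p : M) :
    ContinuousOn (fun z : M × EuclideanSpace ℝ (Fin d) ↦
      tv z.1 (Cinv p z.1 z.2)) (src (d := d) p ×ˢ univ) := by
  have h := (trivializationAt (EuclideanSpace ℝ (Fin d))
    (fun x : M ↦ TangentSpace (𝓡 d) x) p).continuousOn_symm
  refine h.congr fun z hz ↦ congrArg (tv z.1) ?_
  exact (trivializationAt (EuclideanSpace ℝ (Fin d))
    (fun x : M ↦ TangentSpace (𝓡 d) x) p).symmL_apply (R := ℝ) hz.1 z.2

lemma continuousAt_tv_Cinv {X : Type*} [TopologicalSpace X] {a : X → M}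
    {b : X → EuclideanSpace ℝ (Fin d)} {t : X} (ha : ContinuousAt a t) (hb : ContinuousAt b t)
    {p : M} (hp : a t ∈ src (d := d) p) :
    ContinuousAt (fun s ↦ tv (a s) (Cinv p (a s) (b s))) t :=
  ContinuousAt.comp (g := fun z : M × EuclideanSpace ℝ (Fin d) ↦ tv z.1 (Cinv p z.1 z.2))
    (f := fun s ↦ (a s, b s)) ((continuousOn_Cinv p).continuousAt
      (prod_mem_nhds ((isOpen_src p).mem_nhds hp) univ_mem)) (ha.prodMk hb)

/-- The tangent map of `g`, read in the trivialization centred at `g p`, is continuous on `TM` at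
the points over `p`. -/
lemma continuousAt_C_D (g : End1 d M) (p : M) (v : EuclideanSpace ℝ (Fin d)) :
    ContinuousAt (fun w : TangentBundle (𝓡 d) M ↦ C (g p) (g w.1) (D g w.1 (vec w))) (tv p v) := by
  have hcq : ContinuousAt (fun w : TangentBundle (𝓡 d) M ↦ C (g p) w.1 (vec w))
      (tangentLift g (tv p v)) :=
    (continuousOn_C (g p)).continuousAt
      (continuous_proj.continuousAt.eventually (src_mem_nhds (d := d) (g p)))
  exact hcq.comp (tangentLift g).continuous.continuousAt

end Trivialization

/-! ### Compactness in the tangent bundle -/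

section Compactness

variable [Bundle.RiemannianBundle (fun x : M ↦ TangentSpace (𝓡 d) x)]
  [IsContMDiffRiemannianBundle (𝓡 d) ∞ (EuclideanSpace ℝ (Fin d))
      (fun x : M ↦ TangentSpace (𝓡 d) x)]

/-- The trivialization at `p` is bounded, for the Riemannian norm, near `p`. -/
lemma eventually_norm_C_le (p : M) : ∃ R > 0, ∀ᶠ y in 𝓝 p, ∀ v : EuclideanSpace ℝ (Fin d),
    ‖C p y v‖ ≤ R * nrm y v := by
  obtain ⟨R, hR, h⟩ := eventually_norm_trivializationAt_lt (EuclideanSpace ℝ (Fin d))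
    (fun x : M ↦ TangentSpace (𝓡 d) x) p
  refine ⟨R, hR, h.mono fun y hy v ↦ ?_⟩
  exact ContinuousLinearMap.le_of_opNorm_le (E := TangentSpace (𝓡 d) y) _ hy.le v

/-- The local form of `exists_thickening`. -/
lemma eventually_add_mem {W : Set (TangentBundle (𝓡 d) M)} (hW : IsOpen W)
    {w₀ : TangentBundle (𝓡 d) M} (h₀ : w₀ ∈ W) :
    ∃ ε > 0, ∀ᶠ w in 𝓝 w₀, ∀ u : EuclideanSpace ℝ (Fin d), nrm w.1 u ≤ ε →
      tv w.1 (vec w + u) ∈ W := by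
  obtain ⟨R, hR, hC⟩ := eventually_norm_C_le (d := d) w₀.1
  have hsrc : ∀ᶠ w : TangentBundle (𝓡 d) M in 𝓝 w₀, w.1 ∈ src (d := d) w₀.1 :=
    continuous_proj.continuousAt.eventually (src_mem_nhds w₀.1)
  -- addition in the fibres, read in the trivialization at the base point of `w₀`
  have hcont : ContinuousAt (fun z : TangentBundle (𝓡 d) M × EuclideanSpace ℝ (Fin d) ↦
      tv z.1.1 (Cinv w₀.1 z.1.1 (C w₀.1 z.1.1 (vec z.1) + z.2)))
      (w₀, 0) := by
    have h1 : ContinuousAt (fun z : M × EuclideanSpace ℝ (Fin d) ↦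
        tv z.1 (Cinv w₀.1 z.1 z.2)) (w₀.1, C w₀.1 w₀.1 (vec w₀) + 0) :=
      (continuousOn_Cinv w₀.1).continuousAt (prod_mem_nhds (src_mem_nhds _) univ_mem)
    have h2 : ContinuousAt (fun w : TangentBundle (𝓡 d) M ↦ C w₀.1 w.1 (vec w)) w₀ :=
      (continuousOn_C w₀.1).continuousAt hsrc
    have h3 : ContinuousAt (fun z : TangentBundle (𝓡 d) M × EuclideanSpace ℝ (Fin d) ↦
        (z.1.1, C w₀.1 z.1.1 (vec z.1) + z.2)) (w₀, 0) :=
      (continuous_proj.continuousAt.comp continuousAt_fst).prodMk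
        ((h2.comp_of_eq continuousAt_fst rfl).add continuousAt_snd)
    exact h1.comp_of_eq h3 rfl
  have hmem : ∀ᶠ z : TangentBundle (𝓡 d) M × EuclideanSpace ℝ (Fin d) in 𝓝 (w₀, 0),
      tv z.1.1 (Cinv w₀.1 z.1.1 (C w₀.1 z.1.1 (vec z.1) + z.2)) ∈ W := by
    refine hcont.eventually_mem (hW.mem_nhds ?_)
    simp only [add_zero]
    rw [Cinv_C (mem_src _)]
    exact h₀
  rw [nhds_prod_eq, eventually_prod_iff] at hmem
  obtain ⟨pa, hpa, pb, hpb, hab⟩ := hmem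
  obtain ⟨δ, hδ, hball⟩ := Metric.eventually_nhds_iff.1 hpb
  refine ⟨δ / (2 * R), by positivity, ?_⟩
  filter_upwards [hpa, hsrc, continuous_proj.continuousAt.eventually hC] with w hw hs hCw u hu
  have hu' : ‖C w₀.1 w.1 u‖ < δ := by
    refine (hCw u).trans_lt ?_
    calc R * nrm w.1 u ≤ R * (δ / (2 * R)) := by gcongr
      _ = δ / 2 := by field_simp
      _ < δ := by linarith
  have := hab hw (hball (y := C w₀.1 w.1 u) (by simpa using hu'))
  simp only [← map_add] at this
  rw [Cinv_C hs] at this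
  exact this

/-- A compact subset of an open subset of `TM` stays inside it after small translations in the
fibres. -/
lemma exists_thickening {L W : Set (TangentBundle (𝓡 d) M)} (hL : IsCompact L) (hW : IsOpen W)
    (hLW : L ⊆ W) :
    ∃ ε > 0, ∀ w ∈ L, ∀ u : EuclideanSpace ℝ (Fin d), nrm w.1 u ≤ ε →
      tv w.1 (vec w + u) ∈ W := by
  refine hL.induction_on (p := fun s ↦ ∃ ε > 0, ∀ w ∈ s, ∀ u : EuclideanSpace ℝ (Fin d),
    nrm w.1 u ≤ ε →
      tv w.1 (vec w + u) ∈ W) ?_ ?_ ?_ ?_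
  · exact ⟨1, one_pos, by simp⟩
  · rintro s t hst ⟨ε, hε, h⟩
    exact ⟨ε, hε, fun w hw ↦ h w (hst hw)⟩
  · rintro s t ⟨ε, hε, h⟩ ⟨ε', hε', h'⟩
    refine ⟨min ε ε', lt_min hε hε', ?_⟩
    rintro w (hw | hw) u hu
    · exact h w hw u (hu.trans (min_le_left _ _))
    · exact h' w hw u (hu.trans (min_le_right _ _))
  · intro w hw
    obtain ⟨ε, hε, h⟩ := eventually_add_mem hW (hLW hw)
    exact ⟨_, mem_nhdsWithin_of_mem_nhds h, ε, hε, fun w hw ↦ hw⟩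

variable [T2Space M] [CompactSpace M]

/-- The unit disc bundle of a compact manifold is compact. -/
lemma isCompact_unitDisc : IsCompact {v : TangentBundle (𝓡 d) M | nrm v.1 (vec v) ≤ 1} := by
  have : LocallyCompactSpace M := Manifold.locallyCompact_of_finiteDimensional (𝓡 d)
  suffices h : ∃ Q : Set (TangentBundle (𝓡 d) M), IsCompact Q ∧
      ∀ v : TangentBundle (𝓡 d) M, v.1 ∈ (univ : Set M) → nrm v.1 (vec v) ≤ 1 → v ∈ Q by
    obtain ⟨Q, hQ, h⟩ := h
    have h' : {v : TangentBundle (𝓡 d) M | nrm v.1 (vec v) ≤ 1} =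
        Q ∩ {v : TangentBundle (𝓡 d) M | nrm v.1 (vec v) ≤ 1} :=
      (inter_eq_right.2 fun v hv ↦ h v (mem_univ _) hv).symm
    rw [h']
    exact hQ.inter_right (isClosed_le continuous_nrm continuous_const)
  refine isCompact_univ.induction_on (p := fun s ↦ ∃ Q : Set (TangentBundle (𝓡 d) M),
    IsCompact Q ∧ ∀ v : TangentBundle (𝓡 d) M, v.1 ∈ s → nrm v.1 (vec v) ≤ 1 → v ∈ Q) ?_ ?_ ?_ ?_
  · exact ⟨∅, isCompact_empty, by simp⟩
  · rintro s t hst ⟨Q, hQ, h⟩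
    exact ⟨Q, hQ, fun v hv ↦ h v (hst hv)⟩
  · rintro s t ⟨Q, hQ, h⟩ ⟨Q', hQ', h'⟩
    exact ⟨Q ∪ Q', hQ.union hQ', fun v hv hv1 ↦ hv.imp (fun hv ↦ h v hv hv1)
      fun hv ↦ h' v hv hv1⟩
  · intro p _
    obtain ⟨R, hR, hC⟩ := eventually_norm_C_le (d := d) p
    obtain ⟨N, hNp, hN, hNc⟩ := LocallyCompactSpace.local_compact_nhds p _
      (inter_mem hC (src_mem_nhds (d := d) p))
    refine ⟨N, mem_nhdsWithin_of_mem_nhds hNp, _,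
      (hNc.prod (isCompact_closedBall (0 : EuclideanSpace ℝ (Fin d)) R)).image_of_continuousOn
        ((continuousOn_Cinv p).mono fun z hz ↦ ⟨(hN hz.1).2, mem_univ _⟩), fun v hv hv1 ↦ ?_⟩
    refine ⟨(v.1, C p v.1 (vec v)), ⟨hv, ?_⟩, ?_⟩
    · rw [mem_closedBall_zero_iff]
      exact ((hN hv).1 (vec v)).trans (mul_le_of_le_one_right hR.le hv1)
    · simp only [Cinv_C (hN hv).2, tv_vec]

lemma nrm_D_le_of_disc {f : End1 d M} {K : ℝ}
    (h : ∀ v : TangentBundle (𝓡 d) M, nrm v.1 (vec v) ≤ 1 → nrm (f v.1) (D f v.1 (vec v)) ≤ K)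
    (x : M) (v : EuclideanSpace ℝ (Fin d)) : nrm (f x) (D f x v) ≤ K * nrm x v := by
  by_cases hv : v = 0
  · simp [hv, nrm_zero]
  have hpos := nrm_pos x hv
  have := h (tv x ((nrm x v)⁻¹ • v)) (by
    rw [vec_tv, tv_proj, nrm_smul, abs_of_pos (inv_pos.2 hpos), inv_mul_cancel₀ hpos.ne'])
  rw [vec_tv, tv_proj, map_smul, nrm_smul, abs_of_pos (inv_pos.2 hpos),
    inv_mul_le_iff₀ hpos] at this
  rwa [mul_comm]

/-- Maps `C¹`-close to `f₀` have uniformly bounded derivatives. -/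
lemma exists_eventually_nrm_D_le (f₀ : End1 d M) :
    ∃ K ≥ 1, ∀ᶠ f in 𝓝 f₀, ∀ (x : M) (v : EuclideanSpace ℝ (Fin d)),
      nrm (f x) (D f x v) ≤ K * nrm x v := by
  have hd := isCompact_unitDisc (d := d) (M := M)
  obtain ⟨R, hR, h⟩ := exists_nrm_le_of_isCompact (hd.image (tangentLift f₀).continuous)
  refine ⟨R + 1, by linarith, ?_⟩
  have hopen : ∀ᶠ F : C(TangentBundle (𝓡 d) M, TangentBundle (𝓡 d) M) in 𝓝 (tangentLift f₀),
      MapsTo F {v : TangentBundle (𝓡 d) M | nrm v.1 (vec v) ≤ 1}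
        {v : TangentBundle (𝓡 d) M | nrm v.1 (vec v) < R + 1} :=
    ContinuousMap.eventually_mapsTo hd (isOpen_lt continuous_nrm continuous_const)
      fun v hv ↦ (h _ ⟨v, hv, rfl⟩).trans_lt (lt_add_one R)
  have hind : Tendsto (tangentLift (d := d) (M := M)) (𝓝 f₀) (𝓝 (tangentLift f₀)) :=
    continuous_induced_dom.tendsto f₀
  filter_upwards [hind.eventually hopen] with f hf
  exact nrm_D_le_of_disc fun v hv ↦ (hf hv).le

end Compactness

/-! ### Cutting off a linear map -/

section Bump

variable [Bundle.RiemannianBundle (fun x : M ↦ TangentSpace (𝓡 d) x)]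

/-- The linear map `Λ`, cut off outside the Riemannian ball of radius `ρ` of the tangent space
at `p`. -/
def cutoff (p : M) (Λ : EuclideanSpace ℝ (Fin d) →L[ℝ] EuclideanSpace ℝ (Fin d)) (ρ : ℝ)
    (u : EuclideanSpace ℝ (Fin d)) : EuclideanSpace ℝ (Fin d) :=
  Real.smoothTransition (1 - ip p u u / ρ ^ 2) • Λ u

lemma contDiff_cutoff (p : M) (Λ : EuclideanSpace ℝ (Fin d) →L[ℝ] EuclideanSpace ℝ (Fin d))
    (ρ : ℝ) : ContDiff ℝ 1 (cutoff p Λ ρ) := by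
  refine (Real.smoothTransition.contDiff.comp ?_).smul Λ.contDiff
  exact contDiff_const.sub (((ip p).contDiff.clm_apply contDiff_id).div_const _)

lemma cutoff_zero (p : M) (Λ : EuclideanSpace ℝ (Fin d) →L[ℝ] EuclideanSpace ℝ (Fin d))
    (ρ : ℝ) : cutoff p Λ ρ 0 = 0 := by simp [cutoff]

lemma cutoff_of_lt {p : M} {Λ : EuclideanSpace ℝ (Fin d) →L[ℝ] EuclideanSpace ℝ (Fin d)}
    {ρ : ℝ} (hρ : 0 < ρ) {u : EuclideanSpace ℝ (Fin d)} (hu : ρ < nrm p u) :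
    cutoff p Λ ρ u = 0 := by
  have : 1 - ip p u u / ρ ^ 2 ≤ 0 := by
    rw [ip_self, sub_nonpos, le_div_iff₀ (by positivity), one_mul]
    exact pow_le_pow_left₀ hρ.le hu.le 2
  rw [cutoff, Real.smoothTransition.zero_of_nonpos this, zero_smul]

lemma fderiv_cutoff_apply (p : M) (Λ : EuclideanSpace ℝ (Fin d) →L[ℝ] EuclideanSpace ℝ (Fin d))
    (ρ : ℝ) (u v : EuclideanSpace ℝ (Fin d)) :
    fderiv ℝ (cutoff p Λ ρ) u v = Real.smoothTransition (1 - ip p u u / ρ ^ 2) • Λ v +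
      (deriv Real.smoothTransition (1 - ip p u u / ρ ^ 2) * -(2 * ip p u v / ρ ^ 2)) • Λ u := by
  have h1 : HasFDerivAt (fun u ↦ ip p u u) ((ip p u) + (ip p).flip u) u := by
    have := (ip p).hasFDerivAt (x := u) |>.clm_apply (hasFDerivAt_id u)
    simpa using this
  have h2 : HasFDerivAt (fun u ↦ 1 - ip p u u / ρ ^ 2)
      (-((ρ ^ 2)⁻¹ • ((ip p u) + (ip p).flip u))) u := by
    have := (h1.const_mul ((ρ ^ 2)⁻¹)).const_sub 1
    refine this.congr_of_eventuallyEq (Eventually.of_forall fun w ↦ ?_)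
    simp only [div_eq_inv_mul]
  have h3 : HasDerivAt Real.smoothTransition
      (deriv Real.smoothTransition (1 - ip p u u / ρ ^ 2)) (1 - ip p u u / ρ ^ 2) :=
    ((Real.smoothTransition.contDiff (n := 1)).differentiable (by simp) _).hasDerivAt
  have h4 := (h3.comp_hasFDerivAt u h2).smul (Λ.hasFDerivAt (x := u))
  have h5 : fderiv ℝ (cutoff p Λ ρ) u = _ := h4.fderiv
  rw [h5]
  simp only [Function.comp_apply, smul_add, neg_add_rev, smul_neg, add_apply, smul_apply,
    ContinuousLinearMap.smulRight_apply, neg_apply, ContinuousLinearMap.flip_apply, ip_comm p v u,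
    smul_eq_mul, mul_neg, neg_smul, add_right_inj]
  rw [← neg_smul]
  congr 1
  ring

lemma fderiv_cutoff_zero (p : M)
    (Λ : EuclideanSpace ℝ (Fin d) →L[ℝ] EuclideanSpace ℝ (Fin d)) (ρ : ℝ)
    (v : EuclideanSpace ℝ (Fin d)) : fderiv ℝ (cutoff p Λ ρ) 0 v = Λ v := by
  rw [fderiv_cutoff_apply]
  simp

lemma nrm_cutoff_le {p q : M} {Λ : EuclideanSpace ℝ (Fin d) →L[ℝ] EuclideanSpace ℝ (Fin d)}
    {ε ρ : ℝ} (hε : 0 ≤ ε) (hΛ : ∀ v, nrm q (Λ v) ≤ ε * nrm p v)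
    {u : EuclideanSpace ℝ (Fin d)} (hu : nrm p u ≤ ρ) : nrm q (cutoff p Λ ρ u) ≤ ε * ρ := by
  rw [cutoff, nrm_smul, abs_of_nonneg (Real.smoothTransition.nonneg _)]
  calc _ ≤ 1 * (ε * nrm p u) := by
        gcongr
        · exact nrm_nonneg _ _
        · exact Real.smoothTransition.le_one _
        · exact hΛ u
    _ ≤ ε * ρ := by rw [one_mul]; gcongr

/-- The cutoff of `Λ` is as small in the `C¹` sense as `Λ` itself, whatever the radius: the
derivative of the cutoff function is of order `1 / ρ`, but it only meets vectors of size at most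
`ρ`. -/
lemma exists_nrm_fderiv_cutoff_le : ∃ c ≥ 1, ∀ (p q : M)
    (Λ : EuclideanSpace ℝ (Fin d) →L[ℝ] EuclideanSpace ℝ (Fin d)) (ε ρ : ℝ), 0 ≤ ε → 0 < ρ →
    (∀ v, nrm q (Λ v) ≤ ε * nrm p v) → ∀ u v, nrm p u ≤ ρ →
    nrm q (fderiv ℝ (cutoff p Λ ρ) u v) ≤ c * ε * nrm p v := by
  have hcont : Continuous (deriv Real.smoothTransition) :=
    (Real.smoothTransition.contDiff (n := 1)).continuous_deriv le_rfl
  obtain ⟨b, hb⟩ := (isCompact_Icc (a := (0 : ℝ)) (b := 1)).exists_bound_of_continuousOn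
    hcont.continuousOn
  have hb0 : 0 ≤ b := (norm_nonneg _).trans (hb 0 (by simp))
  refine ⟨1 + 2 * b, by linarith, fun p q Λ ε ρ hε hρ hΛ u v hu ↦ ?_⟩
  have hu0 := nrm_nonneg p u
  have hv0 := nrm_nonneg p v
  have hmem : 1 - ip p u u / ρ ^ 2 ∈ Icc (0 : ℝ) 1 := by
    rw [ip_self]
    have : nrm p u ^ 2 / ρ ^ 2 ≤ 1 := by
      rw [div_le_one (by positivity)]
      exact pow_le_pow_left₀ hu0 hu 2
    have : 0 ≤ nrm p u ^ 2 / ρ ^ 2 := by positivity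
    constructor <;> linarith
  rw [fderiv_cutoff_apply]
  refine (nrm_add _ _ _).trans ?_
  rw [nrm_smul, nrm_smul, abs_of_nonneg (Real.smoothTransition.nonneg _), abs_mul, abs_neg,
    abs_div, abs_mul, abs_two, abs_of_pos (by positivity : 0 < ρ ^ 2)]
  have h1 : Real.smoothTransition (1 - ip p u u / ρ ^ 2) * nrm q (Λ v) ≤ 1 * (ε * nrm p v) := by
    gcongr
    · exact nrm_nonneg _ _
    · exact Real.smoothTransition.le_one _
    · exact hΛ v
  have h2 : |deriv Real.smoothTransition (1 - ip p u u / ρ ^ 2)| *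
      (2 * |ip p u v| / ρ ^ 2) * nrm q (Λ u) ≤ b * (2 * (ρ * nrm p v) / ρ ^ 2) * (ε * ρ) := by
    gcongr
    · exact nrm_nonneg _ _
    · exact hb _ hmem
    · exact (abs_ip_le p u v).trans (by gcongr)
    · exact (hΛ u).trans (by gcongr)
  have h3 : b * (2 * (ρ * nrm p v) / ρ ^ 2) * (ε * ρ) = 2 * b * ε * nrm p v := by
    field_simp
  linarith

end Bump

/-! ### Perturbing a map in charts -/

section LocalPerturbation

variable [T2Space M]

/-- Adding to `g`, read in the charts at `p` and `g p`, a `C¹` map `h` that vanishes outside the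
closed set `S` gives a `C¹` map of `M`; in the trivializations its derivative is the sum of those
of `g` and of `h`. -/
lemma exists_add_in_charts (g : End1 d M) (p : M)
    {h : EuclideanSpace ℝ (Fin d) → EuclideanSpace ℝ (Fin d)} (hh : ContDiff ℝ 1 h)
    {S : Set M} (hS : IsClosed S) (hSp : S ⊆ src (d := d) p)
    (hSg : ∀ y ∈ S, g y ∈ src (d := d) (g p))
    (hout : ∀ y ∈ src (d := d) p, y ∉ S → h (extChartAt (𝓡 d) p y - extChartAt (𝓡 d) p p) = 0)
    (hin : ∀ y ∈ S, extChartAt (𝓡 d) (g p) (g y) +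
      h (extChartAt (𝓡 d) p y - extChartAt (𝓡 d) p p) ∈ (extChartAt (𝓡 d) (g p)).target) :
    ∃ g' : End1 d M, (∀ y ∉ S, ⇑g' =ᶠ[𝓝 y] ⇑g) ∧ ∀ y ∈ S,
      g' y = (extChartAt (𝓡 d) (g p)).symm (extChartAt (𝓡 d) (g p) (g y) +
        h (extChartAt (𝓡 d) p y - extChartAt (𝓡 d) p p)) ∧
      g' y ∈ src (d := d) (g p) ∧
      ∀ v, C (g p) (g' y) (D g' y v) = C (g p) (g y) (D g y v) +
        fderiv ℝ h (extChartAt (𝓡 d) p y - extChartAt (𝓡 d) p p) (C p y v) := by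
  classical
  set φ := extChartAt (𝓡 d) p with hφ
  set ψ := extChartAt (𝓡 d) (g p) with hψ
  set F : M → EuclideanSpace ℝ (Fin d) := fun y ↦ ψ (g y) + h (φ y - φ p) with hF
  set k : M → M := fun y ↦ if y ∈ S then ψ.symm (F y) else g y with hk
  set O : Set M := src (d := d) p ∩ g ⁻¹' src (d := d) (g p) with hO
  have hOo : IsOpen O := (isOpen_src p).inter ((isOpen_src (g p)).preimage g.contMDiff.continuous)
  have hFO : ∀ y ∈ O, ContMDiffAt (𝓡 d) 𝓘(ℝ, EuclideanSpace ℝ (Fin d)) 1 F y := by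
    intro y hy
    refine ContMDiffAt.add ?_ ?_
    · exact (contMDiffAt_extChartAt' (n := 1) hy.2).comp y (g.contMDiff y)
    · exact hh.contMDiff.contMDiffAt.comp y
        ((contMDiffAt_extChartAt' (n := 1) hy.1).sub contMDiffAt_const)
  set O' : Set M := {y ∈ O | F y ∈ ψ.target} with hO'
  have hO'n : ∀ y ∈ O', O' ∈ 𝓝 y := fun y hy ↦
    inter_mem (hOo.mem_nhds hy.1) ((hFO y hy.1).continuousAt.preimage_mem_nhds
      ((isOpen_extChartAt_target (g p)).mem_nhds hy.2))
  have hSO : S ⊆ O' := fun y hy ↦ ⟨⟨hSp hy, hSg y hy⟩, hin y hy⟩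
  have hkO : ∀ y ∈ O', k y = ψ.symm (F y) := by
    intro y hy
    by_cases hyS : y ∈ S
    · simp [hk, hyS]
    · have : F y = ψ (g y) := by simp [hF, hout y hy.1.1 hyS]
      rw [this, ψ.left_inv (by rw [hψ, extChartAt_source]; exact hy.1.2)]
      simp [hk, hyS]
  have hkS : ∀ y ∉ S, k =ᶠ[𝓝 y] g := fun y hy ↦
    Filter.Eventually.mono (hS.isOpen_compl.mem_nhds hy) fun z hz ↦ by simp [hk, hz]
  have hkc : ContMDiff (𝓡 d) (𝓡 d) 1 k := by
    intro y
    by_cases hyS : y ∈ S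
    · have hy := hSO hyS
      have h1 : ContMDiffAt (𝓡 d) (𝓡 d) 1 (ψ.symm ∘ F) y :=
        ((contMDiffOn_extChartAt_symm (n := 1) (g p)).contMDiffAt
          ((isOpen_extChartAt_target (g p)).mem_nhds hy.2)).comp y (hFO y hy.1)
      exact h1.congr_of_eventuallyEq (Filter.Eventually.mono (hO'n y hy) fun z hz ↦ hkO z hz)
    · exact (g.contMDiff y).congr_of_eventuallyEq (hkS y hyS)
  refine ⟨⟨k, hkc⟩, hkS, fun y hyS ↦ ?_⟩
  have hy := hSO hyS
  have hky : k y ∈ src (d := d) (g p) := by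
    rw [hkO y hy]
    have := ψ.map_target hy.2
    rwa [hψ, extChartAt_source] at this
  refine ⟨hkO y hy, hky, fun v ↦ ?_⟩
  have hψd : ∀ z ∈ src (d := d) (g p),
      HasMFDerivAt (𝓡 d) 𝓘(ℝ, EuclideanSpace ℝ (Fin d)) ψ z (C (d := d) (g p) z) := fun z hz ↦ by
    rw [C_eq_mfderiv hz]
    exact (mdifferentiableAt_extChartAt hz).hasMFDerivAt
  have hφd : HasMFDerivAt (𝓡 d) 𝓘(ℝ, EuclideanSpace ℝ (Fin d)) φ y (C (d := d) p y) := by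
    rw [C_eq_mfderiv hy.1.1]
    exact (mdifferentiableAt_extChartAt hy.1.1).hasMFDerivAt
  have e1 : HasMFDerivAt (𝓡 d) 𝓘(ℝ, EuclideanSpace ℝ (Fin d)) (ψ ∘ k) y
      ((C (d := d) (g p) (k y)).comp (mfderiv (𝓡 d) (𝓡 d) k y :
        EuclideanSpace ℝ (Fin d) →L[ℝ] EuclideanSpace ℝ (Fin d))) :=
    (hψd _ hky).comp y (hkc.mdifferentiable one_ne_zero y).hasMFDerivAt
  have e2 : HasMFDerivAt (𝓡 d) 𝓘(ℝ, EuclideanSpace ℝ (Fin d)) (ψ ∘ g) y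
      ((C (d := d) (g p) (g y)).comp (D g y)) :=
    (hψd _ hy.1.2).comp y (mdifferentiable g y).hasMFDerivAt
  have e3 : HasFDerivAt (fun u ↦ h (u - φ p)) (fderiv ℝ h (φ y - φ p)) (φ y) := by
    have := (hh.differentiable one_ne_zero (φ y - φ p)).hasFDerivAt.comp (φ y)
      ((hasFDerivAt_id (φ y)).sub_const (φ p))
    rw [ContinuousLinearMap.comp_id] at this
    exact this
  have e4 : HasMFDerivAt (𝓡 d) 𝓘(ℝ, EuclideanSpace ℝ (Fin d)) (fun y ↦ h (φ y - φ p)) y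
      ((fderiv ℝ h (φ y - φ p)).comp (C (d := d) p y)) :=
    e3.hasMFDerivAt.comp y hφd
  have e5 := e2.add e4
  have e6 : HasMFDerivAt (𝓡 d) 𝓘(ℝ, EuclideanSpace ℝ (Fin d)) (ψ ∘ k) y _ :=
    e5.congr_of_eventuallyEq (Filter.Eventually.mono (hO'n y hy) fun z hz ↦ by
      simp only [Function.comp_apply, hkO z hz]
      exact ψ.right_inv hz.2)
  exact congrArg (fun T : EuclideanSpace ℝ (Fin d) →L[ℝ] EuclideanSpace ℝ (Fin d) ↦ T v)
    (hasMFDerivAt_unique e1 e6)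

end LocalPerturbation

/-! ### Perturbing the derivative at one point -/

section SinglePoint

variable [Bundle.RiemannianBundle (fun x : M ↦ TangentSpace (𝓡 d) x)]

/-- The points of the chart at `p` at distance at most `ρ` from `p`, measured in the chart with
the inner product of the tangent space at `p`. -/
def chartBall (p : M) (ρ : ℝ) : Set M :=
  {y | y ∈ src (d := d) p ∧ nrm p (extChartAt (𝓡 d) p y - extChartAt (𝓡 d) p p) ≤ ρ}

variable [IsContMDiffRiemannianBundle (𝓡 d) ∞ (EuclideanSpace ℝ (Fin d))
      (fun x : M ↦ TangentSpace (𝓡 d) x)]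

/-- The Riemannian norm at one point is bounded below by the norm of the model space. -/
lemma exists_norm_le_nrm (p : M) :
    ∃ R > 0, ∀ v : EuclideanSpace ℝ (Fin d), ‖v‖ ≤ R * nrm p v := by
  obtain ⟨R, hR, h⟩ := eventually_norm_C_le (d := d) p
  exact ⟨R, hR, fun v ↦ by simpa only [C_self] using h.self_of_nhds v⟩

lemma isCompact_nrm_le (p : M) (r : ℝ) :
    IsCompact {v : EuclideanSpace ℝ (Fin d) | nrm p v ≤ r} := by
  obtain ⟨R, hR, h⟩ := exists_norm_le_nrm (d := d) p
  refine Metric.isCompact_of_isClosed_isBounded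
    (isClosed_le (continuous_nrm_apply p) continuous_const)
    (Metric.isBounded_closedBall (x := 0) (r := R * r) |>.subset fun v hv ↦ ?_)
  rw [mem_closedBall_zero_iff]
  exact (h v).trans (mul_le_mul_of_nonneg_left hv hR.le)

lemma eventually_chartBall_subset (p : M) {V : Set M} (hV : V ∈ 𝓝 p) :
    ∀ᶠ ρ in 𝓝 (0 : ℝ), chartBall (d := d) p ρ ⊆ V := by
  obtain ⟨R, hR, h⟩ := exists_norm_le_nrm (d := d) p
  have h1 := extChartAt_preimage_mem_nhds (I := 𝓡 d) hV
  obtain ⟨δ, hδ, hb⟩ := Metric.mem_nhds_iff.1 h1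
  have h2 : ∀ᶠ ρ in 𝓝 (0 : ℝ), R * ρ < δ :=
    (continuous_const.mul continuous_id).continuousAt.eventually_lt continuousAt_const
      (by simpa using hδ)
  filter_upwards [h2] with ρ hρ y hy
  have : extChartAt (𝓡 d) p y ∈ Metric.ball (extChartAt (𝓡 d) p p) δ := by
    rw [mem_ball_iff_norm]
    exact ((h _).trans (mul_le_mul_of_nonneg_left hy.2 hR.le)).trans_lt hρ
  have := hb this
  rwa [mem_preimage, (extChartAt (𝓡 d) p).left_inv
    (by rw [extChartAt_source]; exact hy.1)] at this

variable [T2Space M]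

lemma eventually_isClosed_chartBall (p : M) :
    ∀ᶠ ρ in 𝓝 (0 : ℝ), IsClosed (chartBall (d := d) p ρ) := by
  obtain ⟨R, hR, h⟩ := exists_norm_le_nrm (d := d) p
  obtain ⟨δ, hδ, hb⟩ := Metric.mem_nhds_iff.1 (extChartAt_target_mem_nhds (I := 𝓡 d) p)
  have h2 : ∀ᶠ ρ in 𝓝 (0 : ℝ), R * ρ < δ :=
    (continuous_const.mul continuous_id).continuousAt.eventually_lt continuousAt_const
      (by simpa using hδ)
  filter_upwards [h2] with ρ hρ
  have hsub : (fun v ↦ v + extChartAt (𝓡 d) p p) '' {v | nrm p v ≤ ρ} ⊆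
      (extChartAt (𝓡 d) p).target := by
    rintro _ ⟨v, hv, rfl⟩
    apply hb
    rw [mem_ball_iff_norm, add_sub_cancel_right]
    exact ((h _).trans (mul_le_mul_of_nonneg_left hv hR.le)).trans_lt hρ
  have : chartBall (d := d) p ρ = (extChartAt (𝓡 d) p).symm ''
      ((fun v ↦ v + extChartAt (𝓡 d) p p) '' {v | nrm p v ≤ ρ}) := by
    ext y
    constructor
    · intro hy
      refine ⟨extChartAt (𝓡 d) p y, ⟨_, hy.2, by simp⟩, ?_⟩
      exact (extChartAt (𝓡 d) p).left_inv (by rw [extChartAt_source]; exact hy.1)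
    · rintro ⟨z, hz, rfl⟩
      have hzt := hsub hz
      obtain ⟨v, hv, rfl⟩ := hz
      refine ⟨?_, ?_⟩
      · have := (extChartAt (𝓡 d) p).map_target hzt
        rwa [extChartAt_source] at this
      · rw [(extChartAt (𝓡 d) p).right_inv hzt, add_sub_cancel_right]
        exact hv
  rw [this]
  exact ((((isCompact_nrm_le p ρ).image (continuous_id.add continuous_const))).image_of_continuousOn
    ((continuousOn_extChartAt_symm p).mono hsub)).isClosed

/-- In small chart balls around `p`, perturbing the value of `g` and of its tangent map by amounts
that are admissible at `p` keeps the image of the compact set `K` in the open set `W`. -/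
lemma eventually_perturbed_mem (g : End1 d M) (p : M) {K W : Set (TangentBundle (𝓡 d) M)}
    (hK : IsCompact K) (hW : IsOpen W) {c : ℝ}
    (hadm : ∀ v : EuclideanSpace ℝ (Fin d), tv p v ∈ K → ∀ e, nrm (g p) e ≤ c * nrm p v →
      tv (g p) (D g p v + e) ∈ W) :
    ∀ᶠ z : ℝ × EuclideanSpace ℝ (Fin d) in 𝓝 (0, 0), ∀ w ∈ K, w.1 ∈ chartBall (d := d) p z.1 →
      ∀ e, nrm (g p) e ≤ c * nrm p (C p w.1 (vec w)) →
      tv ((extChartAt (𝓡 d) (g p)).symm (extChartAt (𝓡 d) (g p) (g w.1) + z.2))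
        (Cinv (g p) ((extChartAt (𝓡 d) (g p)).symm (extChartAt (𝓡 d) (g p) (g w.1) + z.2))
          (C (g p) (g w.1) (D g w.1 (vec w)) + e)) ∈ W := by
  set φ := extChartAt (𝓡 d) p with hφ
  set ψ := extChartAt (𝓡 d) (g p) with hψ
  refine hK.eventually_forall_of_forall_eventually fun w₀ hw₀ ↦ ?_
  by_cases hp : w₀.1 = p
  swap
  · obtain ⟨V, V', hV, hV', hpV, hwV, hdisj⟩ := t2_separation (Ne.symm hp)
    have h1 : ∀ᶠ z : (ℝ × EuclideanSpace ℝ (Fin d)) × TangentBundle (𝓡 d) M in 𝓝 ((0, 0), w₀),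
        chartBall (d := d) p z.1.1 ⊆ V := by
      have h0 : Tendsto (fun z : (ℝ × EuclideanSpace ℝ (Fin d)) × TangentBundle (𝓡 d) M ↦ z.1.1)
          (𝓝 ((0, 0), w₀)) (𝓝 0) := (continuous_fst.comp continuous_fst).tendsto' _ _ rfl
      exact h0.eventually (eventually_chartBall_subset p (hV.mem_nhds hpV))
    have h2 : ∀ᶠ z : (ℝ × EuclideanSpace ℝ (Fin d)) × TangentBundle (𝓡 d) M in 𝓝 ((0, 0), w₀),
        z.2.1 ∈ V' :=
      (continuous_proj.comp continuous_snd).continuousAt.eventually (hV'.mem_nhds hwV)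
    filter_upwards [h1, h2] with z hz1 hz2 hz3
    exact absurd hz2 (hdisj.notMem_of_mem_left (hz1 hz3))
  obtain ⟨v₀, rfl⟩ := exists_eq_tv hp
  set q := g p with hq
  have hsrc : ∀ᶠ w : TangentBundle (𝓡 d) M in 𝓝 (tv p v₀), w.1 ∈ src (d := d) p :=
    continuous_proj.continuousAt.eventually (src_mem_nhds _)
  have hC : ContinuousAt (fun w : TangentBundle (𝓡 d) M ↦ c * nrm p (C p w.1 (vec w)))
      (tv p v₀) :=
    continuousAt_const.mul ((continuous_nrm_apply p).continuousAt.comp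
      ((continuousOn_C p).continuousAt hsrc))
  have hCv : c * nrm p (C p (tv p v₀).1 (vec (tv p v₀))) = c * nrm p v₀ := by
    rw [tv_proj, vec_tv, C_self]
  -- it is enough to consider `e` in a compact set
  set B : Set (EuclideanSpace ℝ (Fin d)) := {e | nrm q e ≤ c * nrm p v₀ + 1} with hB
  have hBc : IsCompact B := isCompact_nrm_le q _
  have hkey : ∀ᶠ z : (ℝ × EuclideanSpace ℝ (Fin d)) × TangentBundle (𝓡 d) M in
      𝓝 ((0, 0), tv p v₀), ∀ e ∈ B, nrm q e ≤ c * nrm p (C p z.2.1 (vec z.2)) →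
      tv (ψ.symm (ψ (g z.2.1) + z.1.2)) (Cinv q (ψ.symm (ψ (g z.2.1) + z.1.2))
          (C q (g z.2.1) (D g z.2.1 (vec z.2)) + e)) ∈ W := by
    refine hBc.eventually_forall_of_forall_eventually fun e₀ he₀ ↦ ?_
    have hsnd : ContinuousAt (fun t : ((ℝ × EuclideanSpace ℝ (Fin d)) × TangentBundle (𝓡 d) M) ×
        EuclideanSpace ℝ (Fin d) ↦ t.1.2) (((0, 0), tv p v₀), e₀) := by fun_prop
    by_cases hadm0 : nrm q e₀ ≤ c * nrm p v₀
    · have hqs : ψ (g (tv p v₀).1) + 0 = ψ q := by simp [hq]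
      have hg1 : ContinuousAt (fun w : TangentBundle (𝓡 d) M ↦ g w.1) (tv p v₀) :=
        (g.contMDiff.continuous.comp continuous_proj).continuousAt
      have c1 : ContinuousAt (fun t : ((ℝ × EuclideanSpace ℝ (Fin d)) × TangentBundle (𝓡 d) M) ×
          EuclideanSpace ℝ (Fin d) ↦ ψ (g t.1.2.1) + t.1.1.2) (((0, 0), tv p v₀), e₀) := by
        refine ContinuousAt.add ?_ (by fun_prop)
        exact ((continuousAt_extChartAt (I := 𝓡 d) q).comp_of_eq hg1 rfl).comp_of_eq hsnd rfl
      have c2 : ContinuousAt (fun t : ((ℝ × EuclideanSpace ℝ (Fin d)) × TangentBundle (𝓡 d) M) ×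
          EuclideanSpace ℝ (Fin d) ↦ ψ.symm (ψ (g t.1.2.1) + t.1.1.2))
          (((0, 0), tv p v₀), e₀) :=
        (continuousAt_extChartAt_symm (I := 𝓡 d) q).comp_of_eq c1 hqs
      have c3 : ContinuousAt (fun w : TangentBundle (𝓡 d) M ↦ C q (g w.1) (D g w.1 (vec w)))
          (tv p v₀) := continuousAt_C_D g p v₀
      have c4 : ContinuousAt (fun t : ((ℝ × EuclideanSpace ℝ (Fin d)) × TangentBundle (𝓡 d) M) ×
          EuclideanSpace ℝ (Fin d) ↦ C q (g t.1.2.1) (D g t.1.2.1 (vec t.1.2)) + t.2)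
          (((0, 0), tv p v₀), e₀) :=
        (c3.comp_of_eq hsnd rfl).add (by fun_prop)
      have hval : ψ.symm (ψ (g (tv p v₀).1) + 0) = q := by
        rw [hqs]
        exact extChartAt_to_inv (I := 𝓡 d) q
      have c5 : ContinuousAt (fun t : ((ℝ × EuclideanSpace ℝ (Fin d)) × TangentBundle (𝓡 d) M) ×
          EuclideanSpace ℝ (Fin d) ↦ tv (ψ.symm (ψ (g t.1.2.1) + t.1.1.2))
            (Cinv q (ψ.symm (ψ (g t.1.2.1) + t.1.1.2))
              (C q (g t.1.2.1) (D g t.1.2.1 (vec t.1.2)) + t.2))) (((0, 0), tv p v₀), e₀) :=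
        continuousAt_tv_Cinv c2 c4 (by
          have hval' : ψ.symm (ψ q + 0) = q := hval
          simp only [tv_proj]
          rw [hval']
          exact mem_src q)
      refine (c5.eventually_mem (hW.mem_nhds ?_)).mono fun t ht _ ↦ ht
      have hval' : ψ.symm (ψ q + 0) = q := hval
      simp only [tv_proj, vec_tv]
      rw [← hq, C_self, hval', Cinv_self]
      exact hadm _ hw₀ _ hadm0
    · have h1 : ∀ᶠ t : ((ℝ × EuclideanSpace ℝ (Fin d)) × TangentBundle (𝓡 d) M) ×
          EuclideanSpace ℝ (Fin d) in 𝓝 (((0, 0), tv p v₀), e₀),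
          c * nrm p (C p t.1.2.1 (vec t.1.2)) < nrm q t.2 := by
        refine ContinuousAt.eventually_lt (hC.comp_of_eq hsnd rfl)
          ((continuous_nrm_apply q).continuousAt.comp continuousAt_snd) ?_
        rw [hCv]
        exact not_le.1 hadm0
      exact h1.mono fun t ht h ↦ absurd ht h.not_gt
  have hsmall : ∀ᶠ z : (ℝ × EuclideanSpace ℝ (Fin d)) × TangentBundle (𝓡 d) M in
      𝓝 ((0, 0), tv p v₀), c * nrm p (C p z.2.1 (vec z.2)) < c * nrm p v₀ + 1 := by
    refine ContinuousAt.eventually_lt (hC.comp_of_eq continuousAt_snd rfl) continuousAt_const ?_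
    rw [hCv]
    exact lt_add_one _
  filter_upwards [hkey, hsmall] with z hz hzs _ e he
  exact hz e (he.trans hzs.le) he

/-- A `C¹` map `g` can be perturbed near one point `p` so as to keep the value at `p` and to change
the derivative there to `D g p + Λ`, provided that, at `p`, perturbations of the size of `Λ` are
allowed by the conditions `Tg (K) ⊆ W` that have to be preserved. -/
lemma exists_perturb_at_point : ∃ c ≥ 1, ∀ {S : Set (Set (TangentBundle (𝓡 d) M) ×
      Set (TangentBundle (𝓡 d) M))}, S.Finite →
    (∀ K W, (K, W) ∈ S → IsCompact K ∧ IsOpen W) →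
    ∀ (g : End1 d M) (p : M) (Λ : EuclideanSpace ℝ (Fin d) →L[ℝ] EuclideanSpace ℝ (Fin d)) (ε : ℝ),
    0 ≤ ε → (∀ v, nrm (g p) (Λ v) ≤ ε * nrm p v) →
    (∀ K W, (K, W) ∈ S → MapsTo (tangentLift g) K W) →
    (∀ K W, (K, W) ∈ S → ∀ v, tv p v ∈ K → ∀ e, nrm (g p) e ≤ c * ε * nrm p v →
      tv (g p) (D g p v + e) ∈ W) →
    ∀ N ∈ 𝓝 p, ∃ g' : End1 d M, (∀ y ∉ N, ⇑g' =ᶠ[𝓝 y] ⇑g) ∧ g' p = g p ∧ D g' p = D g p + Λ ∧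
      ∀ K W, (K, W) ∈ S → MapsTo (tangentLift g') K W := by
  obtain ⟨c, hc1, hc⟩ := exists_nrm_fderiv_cutoff_le (d := d) (M := M)
  refine ⟨c, hc1, fun {S} hS hKW g p Λ ε hε hΛ hmaps hadm N hN ↦ ?_⟩
  obtain ⟨R, hR, hRn⟩ := exists_norm_le_nrm (d := d) (g p)
  set φ := extChartAt (𝓡 d) p with hφ
  set ψ := extChartAt (𝓡 d) (g p) with hψ
  have hsmall : ∀ δ > 0, ∀ᶠ ρ in 𝓝 (0 : ℝ), R * (ε * ρ) < δ := fun δ hδ ↦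
    (Continuous.continuousAt (by fun_prop)).eventually_lt continuousAt_const (by simpa using hδ)
  -- points of small chart balls are mapped inside the chart at `g p`, also after perturbation
  have htarget : ∀ᶠ ρ in 𝓝 (0 : ℝ), ∀ y ∈ chartBall (d := d) p ρ, ∀ h, ‖h‖ ≤ R * (ε * ρ) →
      ψ (g y) + h ∈ ψ.target := by
    have h1 : ContinuousAt (fun z : M × EuclideanSpace ℝ (Fin d) ↦ ψ (g z.1) + z.2) (p, 0) := by
      refine ContinuousAt.add ?_ continuousAt_snd
      exact (continuousAt_extChartAt (I := 𝓡 d) (g p)).comp_of_eq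
        (g.contMDiff.continuous.continuousAt.comp_of_eq continuousAt_fst rfl) rfl
    have h2 : ∀ᶠ z : M × EuclideanSpace ℝ (Fin d) in 𝓝 (p, 0), ψ (g z.1) + z.2 ∈ ψ.target :=
      h1.eventually_mem (by
        simp only [add_zero]
        exact extChartAt_target_mem_nhds (I := 𝓡 d) (g p))
    rw [nhds_prod_eq, eventually_prod_iff] at h2
    obtain ⟨pa, hpa, pb, hpb, hab⟩ := h2
    obtain ⟨δ, hδ, hball⟩ := Metric.eventually_nhds_iff.1 hpb
    filter_upwards [eventually_chartBall_subset (d := d) p hpa, hsmall δ hδ] with ρ h3 h4 y hy h hh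
    exact hab (h3 hy) (hball (by simpa using hh.trans_lt h4))
  have hW : ∀ᶠ ρ in 𝓝 (0 : ℝ), ∀ KW ∈ S, ∀ w ∈ KW.1, w.1 ∈ chartBall (d := d) p ρ →
      ∀ h, ‖h‖ ≤ R * (ε * ρ) → ∀ e, nrm (g p) e ≤ c * ε * nrm p (C p w.1 (vec w)) →
      tv (ψ.symm (ψ (g w.1) + h)) (Cinv (g p) (ψ.symm (ψ (g w.1) + h))
          (C (g p) (g w.1) (D g w.1 (vec w)) + e)) ∈ KW.2 := by
    rw [eventually_all_finite hS]
    rintro ⟨K, W⟩ hKWS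
    have h1 := eventually_perturbed_mem g p (hKW K W hKWS).1 (hKW K W hKWS).2
      (hadm K W hKWS)
    rw [nhds_prod_eq, eventually_prod_iff] at h1
    obtain ⟨pa, hpa, pb, hpb, hab⟩ := h1
    obtain ⟨δ, hδ, hball⟩ := Metric.eventually_nhds_iff.1 hpb
    filter_upwards [hpa, hsmall δ hδ] with ρ h3 h4 w hw hwb h hh e he
    exact hab h3 (hball (y := h) (by simpa using hh.trans_lt h4)) w hw hwb e he
  have hnhds : N ∩ (src (d := d) p ∩ g ⁻¹' src (d := d) (g p)) ∈ 𝓝 p :=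
    inter_mem hN (inter_mem (src_mem_nhds p)
      (g.contMDiff.continuous.continuousAt.preimage_mem_nhds (src_mem_nhds (g p))))
  have hall := ((htarget.and hW).and ((eventually_isClosed_chartBall (d := d) p).and
    (eventually_chartBall_subset (d := d) p hnhds))).filter_mono (nhdsWithin_le_nhds (s := Ioi 0))
  obtain ⟨ρ, ⟨⟨ht, hWρ⟩, hcl, hsub⟩, hρ⟩ := (hall.and self_mem_nhdsWithin).exists
  replace hρ : 0 < ρ := hρ
  have hcut : ∀ y ∈ chartBall (d := d) p ρ, ‖cutoff p Λ ρ (φ y - φ p)‖ ≤ R * (ε * ρ) :=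
    fun y hy ↦ (hRn _).trans (mul_le_mul_of_nonneg_left (nrm_cutoff_le hε hΛ hy.2) hR.le)
  obtain ⟨g', hg'out, hg'in⟩ := exists_add_in_charts g p (contDiff_cutoff p Λ ρ) hcl
    (fun y hy ↦ hy.1) (fun y hy ↦ (hsub hy).2.2)
    (fun y hy hyS ↦ cutoff_of_lt hρ (not_le.1 fun h ↦ hyS ⟨hy, h⟩))
    (fun y hy ↦ ht y hy _ (hcut y hy))
  have hpmem : p ∈ chartBall (d := d) p ρ := ⟨mem_src p, by rw [sub_self, nrm_zero]; exact hρ.le⟩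
  obtain ⟨hp1, hp2, hp3⟩ := hg'in p hpmem
  rw [sub_self, cutoff_zero, add_zero, extChartAt_to_inv] at hp1
  refine ⟨g', fun y hy ↦ hg'out y fun h ↦ hy (hsub h).1, hp1, ?_, ?_⟩
  · ext1 v
    have := hp3 v
    rwa [hp1, sub_self, fderiv_cutoff_zero, C_self, C_self, C_self] at this
  · intro K W hS w hw
    by_cases hwb : w.1 ∈ chartBall (d := d) p ρ
    · obtain ⟨h1, h2, h3⟩ := hg'in w.1 hwb
      rw [tangentLift_apply, ← Cinv_C h2 (D g' w.1 (vec w)), h3, h1]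
      exact hWρ (K, W) hS w hw hwb _ (hcut _ hwb) _ (hc p (g p) Λ ε ρ hε hρ hΛ _ _ hwb.2)
    · have h1 := hg'out w.1 hwb
      have h2 : tangentLift g' w = tangentLift g w := by
        rw [tangentLift_apply, tangentLift_apply, h1.self_of_nhds]
        exact congrArg (fun T : EuclideanSpace ℝ (Fin d) →L[ℝ] EuclideanSpace ℝ (Fin d) ↦
          tv (g w.1) (T (vec w))) h1.mfderiv_eq
      rw [h2]
      exact hmaps K W hS hw

end SinglePoint

/-! ### Franks' lemma -/

section Franks

variable [Bundle.RiemannianBundle (fun x : M ↦ TangentSpace (𝓡 d) x)]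
  [IsContMDiffRiemannianBundle (𝓡 d) ∞ (EuclideanSpace ℝ (Fin d))
      (fun x : M ↦ TangentSpace (𝓡 d) x)] [T2Space M]

lemma D_congr {f g : End1 d M} {p : M} (h : ⇑f =ᶠ[𝓝 p] ⇑g) : D f p = D g p := h.mfderiv_eq

/-- **Franks' lemma**: every small perturbation of the derivatives of `f` at finitely many points is
realized by a map `C¹`-close to `f` with the same values at these points; the size of the
perturbation is uniform for `f` close to `f₀`, and independent of the points and of their number. -/
lemma exists_franks (f₀ : End1 d M) {U : Set (End1 d M)} (hU : U ∈ 𝓝 f₀) :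
    ∃ U' ∈ 𝓝 f₀, ∃ ε > 0, ∀ f ∈ U', ∀ (s : Finset M)
      (B : M → EuclideanSpace ℝ (Fin d) →L[ℝ] EuclideanSpace ℝ (Fin d)),
      (∀ p ∈ s, ∀ v, nrm (f p) (B p v - D f p v) ≤ ε * nrm p v) →
      ∃ g ∈ U, ∀ p ∈ s, g p = f p ∧ D g p = B p := by
  classical
  have hlc : LocallyCompactSpace (TangentBundle (𝓡 d) M) :=
    Manifold.locallyCompact_of_finiteDimensional (𝓡 d).tangent
  obtain ⟨c, hc1, hc⟩ := exists_perturb_at_point (d := d) (M := M)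
  rw [nhds_induced, mem_comap] at hU
  obtain ⟨V, hV, hVU⟩ := hU
  obtain ⟨S, hS, hSf, hSV⟩ := ContinuousMap.mem_nhds_iff.1 hV
  -- compact neighbourhoods `L` leave room between the images `Tf (K)` and the open sets `W`
  have hL : ∀ KW ∈ S, ∃ L, IsCompact L ∧ tangentLift f₀ '' KW.1 ⊆ interior L ∧ L ⊆ KW.2 :=
    fun KW h ↦ exists_compact_between ((hSf _ _ h).1.image (tangentLift f₀).continuous)
      (hSf _ _ h).2.1 (hSf _ _ h).2.2.image_subset
  choose! L hLc hfL hLW using hL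
  have hε : ∃ ε > 0, ∀ KW ∈ S, ∀ w ∈ KW.1, ∀ w' ∈ L KW, ∀ u : EuclideanSpace ℝ (Fin d),
      nrm w'.1 u ≤ c * ε * nrm w.1 (vec w) → tv w'.1 (vec w' + u) ∈ KW.2 := by
    have h1 : ∀ᶠ ε in 𝓝[>] (0 : ℝ), ∀ KW ∈ S, ∀ w ∈ KW.1, ∀ w' ∈ L KW,
        ∀ u : EuclideanSpace ℝ (Fin d),
        nrm w'.1 u ≤ c * ε * nrm w.1 (vec w) → tv w'.1 (vec w' + u) ∈ KW.2 := by
      rw [eventually_all_finite hS]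
      intro KW hKW
      obtain ⟨R, hR, hRK⟩ := exists_nrm_le_of_isCompact (hSf _ _ hKW).1
      obtain ⟨δ, hδ, hth⟩ := exists_thickening (hLc _ hKW) (hSf _ _ hKW).2.1 (hLW _ hKW)
      have h2 : ∀ᶠ ε in 𝓝[>] (0 : ℝ), c * ε * R < δ :=
        ((Continuous.continuousAt (by fun_prop)).eventually_lt continuousAt_const
          (by simpa using hδ)).filter_mono nhdsWithin_le_nhds
      filter_upwards [h2, self_mem_nhdsWithin] with ε hε hε0 w hw w' hw' u hu
      refine hth w' hw' u (hu.trans (le_trans ?_ hε.le))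
      have hε0' : 0 < ε := hε0
      gcongr
      exact hRK w hw
    obtain ⟨ε, h, hε⟩ := (h1.and self_mem_nhdsWithin).exists
    exact ⟨ε, hε, h⟩
  obtain ⟨ε, hε0, hε⟩ := hε
  have hind : Tendsto (tangentLift (d := d) (M := M)) (𝓝 f₀) (𝓝 (tangentLift f₀)) :=
    continuous_induced_dom.tendsto f₀
  refine ⟨{f | ∀ KW ∈ S, MapsTo (tangentLift f) KW.1 (interior (L KW))}, ?_, ε, hε0, ?_⟩
  · refine (eventually_all_finite hS).2 fun KW hKW ↦ ?_
    have h1 : ∀ᶠ F : C(TangentBundle (𝓡 d) M, TangentBundle (𝓡 d) M) in 𝓝 (tangentLift f₀),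
        MapsTo F KW.1 (interior (L KW)) :=
      ContinuousMap.eventually_mapsTo (hSf _ _ hKW).1 isOpen_interior
        (mapsTo_iff_image_subset.2 (hfL _ hKW))
    exact hind.eventually h1
  intro f hf s B hB
  -- the points are treated one at a time; the germ of `f` at the other points is kept
  suffices h : ∀ t : Finset M, t ⊆ s → ∃ g : End1 d M,
        (∀ K W, (K, W) ∈ S → MapsTo (tangentLift g) K W) ∧
        (∀ p ∈ t, g p = f p ∧ D g p = B p) ∧
        ∀ p ∈ s, p ∉ t → ⇑g =ᶠ[𝓝 p] ⇑f by
    obtain ⟨g, hg1, hg2, -⟩ := h s subset_rfl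
    exact ⟨g, hVU (hSV hg1), hg2⟩
  intro t
  induction t using Finset.induction_on with
  | empty =>
    exact fun _ ↦ ⟨f, fun K W hKW w hw ↦ hLW _ hKW (interior_subset (hf (K, W) hKW hw)),
      by simp, fun p _ _ ↦ EventuallyEq.rfl⟩
  | insert p t hpt ih =>
    intro hts
    rw [Finset.insert_subset_iff] at hts
    obtain ⟨g, hgS, hgt, hgs⟩ := ih hts.2
    have hgp := hgs p hts.1 hpt
    have hDp : D g p = D f p := D_congr hgp
    have hN : ((s.erase p : Finset M) : Set M)ᶜ ∈ 𝓝 p :=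
      (s.erase p).finite_toSet.isClosed.isOpen_compl.mem_nhds (by simp)
    obtain ⟨g', hg'N, hg'p, hDg', hg'S⟩ := hc hS (fun K W h ↦ ⟨(hSf K W h).1, (hSf K W h).2.1⟩)
      g p (B p - D f p) ε hε0.le
      (by rw [hgp.self_of_nhds]; exact hB p hts.1) hgS (by
        rw [hgp.self_of_nhds, hDp]
        exact fun K W hKW v hv e he ↦ hε (K, W) hKW (tv p v) hv (tangentLift f (tv p v))
          (interior_subset (hf (K, W) hKW hv)) e he) _ hN
    have hoff : ∀ y ∈ s, y ≠ p → ⇑g' =ᶠ[𝓝 y] ⇑g := fun y hy hyp ↦ hg'N y (by simp [hy, hyp])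
    refine ⟨g', hg'S, fun y hy ↦ ?_, fun y hy hyt ↦ ?_⟩
    · rcases Finset.mem_insert.1 hy with rfl | hy
      · exact ⟨hg'p.trans hgp.self_of_nhds, by rw [hDg', hDp, add_sub_cancel]⟩
      · have hyo := hoff y (hts.2 hy) (fun h ↦ hpt (h ▸ hy))
        rw [hyo.self_of_nhds, D_congr hyo]
        exact hgt y hy
    · rw [Finset.mem_insert, not_or] at hyt
      exact (hoff y hy hyt.1).trans (hgs y hy hyt.2)

/-- If `B` is close to the derivative of `g` at `p`, then `B`, transported by the trivializations,
is close to the derivatives of `g` at the points near `p`. -/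
lemma eventually_nrm_conj_sub_le (g : End1 d M) (p : M)
    {B : EuclideanSpace ℝ (Fin d) →L[ℝ] EuclideanSpace ℝ (Fin d)} {ε ε' : ℝ} (hε : ε < ε')
    (hB : ∀ v, nrm (g p) (B v - D g p v) ≤ ε * nrm p v) :
    ∀ᶠ z in 𝓝 p, ∀ v,
      nrm (g z) (Cinv (g p) (g z) (B (C p z v)) - D g z v) ≤ ε' * nrm z v := by
  set q := g p with hq
  have hg : ContinuousAt g p := g.contMDiff.continuous.continuousAt
  have hsrc : ∀ᶠ z in 𝓝 p, z ∈ src (d := d) p ∧ g z ∈ src (d := d) q :=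
    (Filter.Eventually.and (src_mem_nhds p) (hg.eventually (src_mem_nhds q)))
  have hsph : ∀ᶠ z in 𝓝 p, ∀ e ∈ Metric.sphere (0 : EuclideanSpace ℝ (Fin d)) 1,
      nrm (g z) (Cinv q (g z) (B e - C q (g z) (D g z (Cinv p z e)))) <
        ε' * nrm z (Cinv p z e) := by
    refine (isCompact_sphere _ _).eventually_forall_of_forall_eventually fun e he ↦ ?_
    have he0 : e ≠ 0 := by rintro rfl; simp at he
    have h1 : ContinuousAt (fun z : M × EuclideanSpace ℝ (Fin d) ↦ tv z.1 (Cinv p z.1 z.2))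
        (p, e) :=
      continuousAt_tv_Cinv continuousAt_fst continuousAt_snd (mem_src p)
    have h2 : ContinuousAt (fun z : M × EuclideanSpace ℝ (Fin d) ↦
        C q (g z.1) (D g z.1 (Cinv p z.1 z.2))) (p, e) :=
      ContinuousAt.comp (g := fun w : TangentBundle (𝓡 d) M ↦ C q (g w.1) (D g w.1 (vec w)))
        (f := fun z : M × EuclideanSpace ℝ (Fin d) ↦ tv z.1 (Cinv p z.1 z.2))
        (continuousAt_C_D g p (Cinv p p e)) h1
    have h3 : ContinuousAt (fun z : M × EuclideanSpace ℝ (Fin d) ↦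
        B z.2 - C q (g z.1) (D g z.1 (Cinv p z.1 z.2))) (p, e) :=
      (B.continuous.comp continuous_snd).continuousAt.sub h2
    have h4 : ContinuousAt (fun z : M × EuclideanSpace ℝ (Fin d) ↦ tv (g z.1) (Cinv q (g z.1)
        (B z.2 - C q (g z.1) (D g z.1 (Cinv p z.1 z.2))))) (p, e) :=
      continuousAt_tv_Cinv (hg.comp_of_eq continuousAt_fst rfl) h3 (mem_src q)
    refine ContinuousAt.eventually_lt (continuousAt_nrm h4)
      (continuousAt_const.mul (continuousAt_nrm h1)) ?_
    change nrm q (Cinv q q (B e - C q q (D g p (Cinv p p e)))) < ε' * nrm p (Cinv p p e)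
    rw [Cinv_self, C_self, Cinv_self]
    exact (hB e).trans_lt (mul_lt_mul_of_pos_right hε (nrm_pos p he0))
  filter_upwards [hsrc, hsph] with z hz hs v
  by_cases hv : v = 0
  · simp [hv, nrm_zero]
  have he0 : C p z v ≠ 0 := fun h ↦ hv (by rw [← Cinv_C hz.1 v, h, map_zero])
  have hpos : 0 < ‖C p z v‖ := norm_pos_iff.2 he0
  have := hs (‖C p z v‖⁻¹ • C p z v) (by
    rw [mem_sphere_zero_iff_norm, norm_smul, norm_inv, norm_norm, inv_mul_cancel₀ hpos.ne'])
  simp only [map_smul, ← smul_sub, Cinv_C hz.1] at this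
  rw [nrm_smul, nrm_smul, abs_of_pos (inv_pos.2 hpos), map_sub, Cinv_C hz.2] at this
  have h := mul_lt_mul_of_pos_left this hpos
  rw [mul_inv_cancel_left₀ hpos.ne', mul_left_comm, mul_inv_cancel_left₀ hpos.ne'] at h
  exact h.le

/-- A vector avoiding the kernels of finitely many nonzero linear maps. -/
lemma exists_forall_apply_ne_zero {ι : Type*} (s : Finset ι)
    (T : ι → EuclideanSpace ℝ (Fin d) →L[ℝ] EuclideanSpace ℝ (Fin d)) (hT : ∀ i ∈ s, T i ≠ 0) :
    ∃ v, ∀ i ∈ s, T i v ≠ 0 := by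
  classical
  have h := Subspace.biUnion_ne_univ_of_top_notMem
    (s := s.image fun i ↦ LinearMap.ker (T i).toLinearMap) (by
      intro h
      obtain ⟨i, hi, h⟩ := Finset.mem_image.1 h
      exact hT i hi (ContinuousLinearMap.coe_injective (LinearMap.ker_eq_top.1 h)))
  obtain ⟨v, hv⟩ := (ne_univ_iff_exists_notMem _).1 h
  refine ⟨v, fun i hi h0 ↦ hv ?_⟩
  simp only [mem_iUnion]
  exact ⟨_, Finset.mem_image_of_mem _ hi, h0⟩

/-- The iterates of `g` separate some points arbitrarily close to `x`, as soon as their derivatives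
at `x` are pairwise different. -/
lemma frequently_injOn_iterate (g : End1 d M) (x : M) (N : ℕ)
    (hne : ∀ i < N, ∀ j < i, iterD g i x ≠ iterD g j x) :
    ∃ᶠ y in 𝓝 x, InjOn (fun j : ℕ ↦ (⇑g)^[j] y) (Iio N) := by
  obtain ⟨h, hh⟩ := exists_forall_apply_ne_zero
    ((Finset.range N ×ˢ Finset.range N).filter fun ij ↦ ij.2 < ij.1)
    (fun ij : ℕ × ℕ ↦ iterD g ij.1 x - iterD g ij.2 x) (by
      rintro ⟨i, j⟩ hij
      simp only [Finset.mem_filter, Finset.mem_product, Finset.mem_range] at hij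
      exact sub_ne_zero.2 (hne i hij.1.1 j hij.2))
  -- the curve through `x` with velocity `h`
  set φ := extChartAt (𝓡 d) x with hφ
  set γ : ℝ → M := fun t ↦ φ.symm (φ x + t • h) with hγ
  have hγ0 : γ 0 = x := by simp [hγ, hφ]
  have hline : HasFDerivAt (fun t : ℝ ↦ φ x + t • h)
      (ContinuousLinearMap.toSpanSingleton ℝ h) 0 := by
    have := ((hasDerivAt_id (0 : ℝ)).smul_const h).const_add (φ x)
    simpa using this.hasFDerivAt
  have hγd : HasMFDerivAt 𝓘(ℝ, ℝ) (𝓡 d) γ 0 (ContinuousLinearMap.toSpanSingleton ℝ h) := by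
    have h1 : HasMFDerivAt 𝓘(ℝ, EuclideanSpace ℝ (Fin d)) (𝓡 d) φ.symm (φ x)
        (ContinuousLinearMap.id ℝ (EuclideanSpace ℝ (Fin d))) := by
      have h2 := (mdifferentiableWithinAt_extChartAt_symm (I := 𝓡 d)
        (mem_extChartAt_target (I := 𝓡 d) x)).hasMFDerivWithinAt
      rw [mfderivWithin_range_extChartAt_symm, ModelWithCorners.range_eq_univ] at h2
      exact hasMFDerivWithinAt_univ.1 h2
    have h3 : HasMFDerivAt 𝓘(ℝ, EuclideanSpace ℝ (Fin d)) (𝓡 d) φ.symm (φ x + (0 : ℝ) • h)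
        (ContinuousLinearMap.id ℝ (EuclideanSpace ℝ (Fin d))) := by
      rwa [zero_smul, add_zero]
    exact h3.comp (0 : ℝ) hline.hasMFDerivAt
  have hγc : Tendsto γ (𝓝[≠] 0) (𝓝 x) := by
    have := hγd.continuousAt.tendsto
    rw [hγ0] at this
    exact this.mono_left nhdsWithin_le_nhds
  have hsep : ∀ᶠ t in 𝓝[≠] (0 : ℝ), ∀ i < N, ∀ j < i, (⇑g)^[i] (γ t) ≠ (⇑g)^[j] (γ t) := by
    have key : ∀ i ∈ Iio N, ∀ j ∈ Iio i, ∀ᶠ t in 𝓝[≠] (0 : ℝ), (⇑g)^[i] (γ t) ≠ (⇑g)^[j] (γ t) := by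
      intro i hi j hj
      have hd : ∀ k, HasMFDerivAt 𝓘(ℝ, ℝ) (𝓡 d) (fun t ↦ (⇑g)^[k] (γ t)) 0
          ((iterD g k x).comp (ContinuousLinearMap.toSpanSingleton ℝ h)) := fun k ↦ by
        have h1 := (mdifferentiable_iterate g k (γ 0)).hasMFDerivAt.comp (0 : ℝ) hγd
        rw [hγ0] at h1
        exact h1
      -- if the two iterates coincide at `x`, the two curves have different velocities there
      by_cases hij : (⇑g)^[i] x = (⇑g)^[j] x
      · set q := (⇑g)^[j] x with hq
        have hψ : ∀ k, (⇑g)^[k] x = q → HasDerivAt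
            (fun t ↦ extChartAt (𝓡 d) q ((⇑g)^[k] (γ t))) (iterD g k x h) 0 := fun k hk ↦ by
          have h1 : HasMFDerivAt (𝓡 d) 𝓘(ℝ, EuclideanSpace ℝ (Fin d)) (extChartAt (𝓡 d) q)
              ((⇑g)^[k] (γ 0)) (ContinuousLinearMap.id ℝ (EuclideanSpace ℝ (Fin d))) := by
            rw [hγ0, hk]
            have := (mdifferentiableAt_extChartAt (I := 𝓡 d) (mem_chart_source _ q)).hasMFDerivAt
            rwa [mfderiv_extChartAt_self] at this
          have h2 : HasFDerivAt (fun t ↦ extChartAt (𝓡 d) q ((⇑g)^[k] (γ t)))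
              ((ContinuousLinearMap.id ℝ _).comp
                ((iterD g k x).comp (ContinuousLinearMap.toSpanSingleton ℝ h))) 0 :=
            (h1.comp (0 : ℝ) (hd k)).hasFDerivAt
          simpa only [ContinuousLinearMap.id_comp, ContinuousLinearMap.comp_apply,
            ContinuousLinearMap.toSpanSingleton_apply,
            one_smul] using h2.hasDerivAt
        have h3 := ((hψ i hij).sub (hψ j rfl)).eventually_ne (c := 0) (by
          have := hh (i, j) (by simpa using ⟨⟨hi, lt_trans hj hi⟩, hj⟩)
          simpa using this)
        filter_upwards [h3] with t ht heq
        exact ht (by simp [heq])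
      · have hc : ∀ k, ContinuousAt (fun t ↦ (⇑g)^[k] (γ t)) 0 := fun k ↦ (hd k).continuousAt
        have h1 : ((⇑g)^[i] (γ 0), (⇑g)^[j] (γ 0)) ∈ (diagonal M)ᶜ := by rwa [hγ0]
        exact (((hc i).prodMk (hc j)).eventually (isClosed_diagonal.isOpen_compl.mem_nhds h1)
          ).filter_mono nhdsWithin_le_nhds
    exact (eventually_all_finite (finite_Iio N)).2 fun i hi ↦
      (eventually_all_finite (finite_Iio i)).2 (key i hi)
  refine hγc.frequently (Eventually.frequently (hsep.mono fun t ht ↦ ?_))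
  intro i hi j hj hij
  rcases lt_trichotomy i j with h | h | h
  · exact absurd hij.symm (ht j hj i h)
  · exact h
  · exact absurd hij (ht i hi j h)

end Franks

/-! ### Perturbations along orbit segments -/

section OrbitSegments

lemma kerDim_eq (f : End1 d M) (n : ℕ) (x : M) :
    kerDim f n x = Module.finrank ℝ (LinearMap.ker (iterD f n x).toLinearMap) := rfl

/-- Rescaling a derivative cocycle by `1 + η`, with `η > 0` small, makes the derivatives of two
iterates different. -/
lemma eventually_smul_ne {i j : ℕ} (hij : j < i)
    {A A' : EuclideanSpace ℝ (Fin d) →L[ℝ] EuclideanSpace ℝ (Fin d)} (hA : A ≠ 0) :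
    ∀ᶠ η in 𝓝[>] (0 : ℝ), (1 + η) ^ i • A ≠ (1 + η) ^ j • A' := by
  by_cases h : A = A'
  · subst h
    filter_upwards [self_mem_nhdsWithin] with η (hη : 0 < η) heq
    have := smul_left_injective ℝ hA heq
    exact (pow_lt_pow_right₀ (by linarith : 1 < 1 + η) hij).ne' this
  · have h1 : ContinuousAt (fun η : ℝ ↦ (1 + η) ^ i • A - (1 + η) ^ j • A') 0 :=
      Continuous.continuousAt (by fun_prop)
    have h2 := h1.eventually_ne (y := 0) (by simpa [sub_eq_zero] using h)
    exact (h2.mono fun η h ↦ sub_ne_zero.1 h).filter_mono nhdsWithin_le_nhds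

lemma iterate_congr {f g : End1 d M} {x : M} {N : ℕ}
    (h : ∀ j < N, g ((⇑f)^[j] x) = f ((⇑f)^[j] x)) {j : ℕ} (hj : j ≤ N) :
    (⇑g)^[j] x = (⇑f)^[j] x := by
  induction j with
  | zero => rfl
  | succ j ih =>
    rw [Function.iterate_succ_apply', Function.iterate_succ_apply', ih (by omega), h j (by omega)]

variable [Bundle.RiemannianBundle (fun x : M ↦ TangentSpace (𝓡 d) x)]
  [IsContMDiffRiemannianBundle (𝓡 d) ∞ (EuclideanSpace ℝ (Fin d))
      (fun x : M ↦ TangentSpace (𝓡 d) x)] [T2Space M]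

/-- A version of Franks' lemma for an orbit segment which may meet the same point several times:
every small perturbation of the derivative cocycle along the segment is realized, up to conjugacy,
along an orbit of a map close to `f₀`. The coincidences in the segment are removed by moving its
starting point, after a rescaling of the derivative has made the derivatives of the iterates
different; this is why they must not vanish. -/
lemma exists_franks_orbit [CompactSpace M] (f₀ : End1 d M) {U : Set (End1 d M)} (hU : U ∈ 𝓝 f₀) :
    ∃ U' ∈ 𝓝 f₀, ∃ ε > 0, ∀ f ∈ U', ∀ (x : M) (N : ℕ)
      (B : ℕ → EuclideanSpace ℝ (Fin d) →L[ℝ] EuclideanSpace ℝ (Fin d)),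
      (∀ i < N, iterD f i x ≠ 0) →
      (∀ j < N, ∀ v, nrm ((⇑f)^[j + 1] x) (B j v - D f ((⇑f)^[j] x) v) ≤
        ε * nrm ((⇑f)^[j] x) v) →
      ∃ g ∈ U, ∃ y, Module.finrank ℝ (LinearMap.ker (cprod B N).toLinearMap) ≤ kerDim g N y := by
  classical
  obtain ⟨U₁, hU₁, ε₁, hε₁, h₁⟩ := exists_franks f₀ hU
  obtain ⟨U₂, hU₂, ε₂, hε₂, h₂⟩ := exists_franks f₀ hU₁
  obtain ⟨K, hK1, hK⟩ := exists_eventually_nrm_D_le f₀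
  refine ⟨U₂ ∩ {f | ∀ (x : M) (v : EuclideanSpace ℝ (Fin d)),
    nrm (f x) (D f x v) ≤ K * nrm x v}, inter_mem hU₂ hK, ε₁ / 4, by positivity, ?_⟩
  rintro f ⟨hfU, hfK⟩ x N B hne hB
  -- rescale the derivative along the orbit to make the derivatives of the iterates different
  obtain ⟨η, hηne, hη, hη0⟩ : ∃ η, (∀ i < N, ∀ j < i,
      (1 + η) ^ i • iterD f i x ≠ (1 + η) ^ j • iterD f j x) ∧ η * K < min ε₂ (ε₁ / 4) ∧ 0 < η := by
    have e1 : ∀ᶠ η in 𝓝[>] (0 : ℝ), ∀ i ∈ Iio N, ∀ j ∈ Iio i,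
        (1 + η) ^ i • iterD f i x ≠ (1 + η) ^ j • iterD f j x :=
      (eventually_all_finite (finite_Iio N)).2 fun i hi ↦
        (eventually_all_finite (finite_Iio i)).2 fun j hj ↦ eventually_smul_ne hj (hne i hi)
    have e2 : ∀ᶠ η in 𝓝[>] (0 : ℝ), η * K < min ε₂ (ε₁ / 4) :=
      ((Continuous.continuousAt (by fun_prop)).eventually_lt continuousAt_const
        (by simp [hε₁, hε₂])).filter_mono nhdsWithin_le_nhds
    obtain ⟨η, h1, h2, h3⟩ := (e1.and (e2.and self_mem_nhdsWithin)).exists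
    exact ⟨η, h1, h2, h3⟩
  have hηD : ∀ (y : M) (v : EuclideanSpace ℝ (Fin d)),
      nrm (f y) ((1 + η) • D f y v - D f y v) ≤ η * K * nrm y v := fun y v ↦ by
    rw [add_smul, one_smul, add_sub_cancel_left, nrm_smul, abs_of_pos hη0, mul_assoc]
    exact mul_le_mul_of_nonneg_left (hfK y v) hη0.le
  obtain ⟨g, hgU, hg⟩ := h₂ f hfU ((Finset.range N).image fun j ↦ (⇑f)^[j] x)
    (fun y ↦ (1 + η) • D f y) (fun y _ v ↦ (hηD y v).trans (mul_le_mul_of_nonneg_right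
      (hη.le.trans (min_le_left _ _)) (nrm_nonneg _ _)))
  have hg' : ∀ j < N, g ((⇑f)^[j] x) = f ((⇑f)^[j] x) ∧
      D g ((⇑f)^[j] x) = (1 + η) • D f ((⇑f)^[j] x) := fun j hj ↦
    hg _ (Finset.mem_image_of_mem _ (Finset.mem_range.2 hj))
  have hit : ∀ j ≤ N, (⇑g)^[j] x = (⇑f)^[j] x := fun j hj ↦
    iterate_congr (fun j hj ↦ (hg' j hj).1) hj
  have hiterD : ∀ i ≤ N, iterD g i x = (1 + η) ^ i • iterD f i x := by
    intro i hi
    induction i with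
    | zero => simp [iterD_zero]
    | succ i ih =>
      rw [iterD_succ, iterD_succ, ih (by omega), hit i (by omega), (hg' i (by omega)).2]
      rw [ContinuousLinearMap.smul_comp, ContinuousLinearMap.comp_smul, smul_smul, pow_succ']
  -- a nearby orbit segment of `g` consisting of different points
  have hfreq := frequently_injOn_iterate g x N fun i hi j hj ↦ by
    rw [hiterD i hi.le, hiterD j (by omega)]
    exact hηne i hi j hj
  have hcont : ∀ j, Tendsto (fun y ↦ (⇑g)^[j] y) (𝓝 x) (𝓝 ((⇑g)^[j] x)) := fun j ↦
    (g.contMDiff.continuous.iterate j).continuousAt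
  have hclose : ∀ᶠ y in 𝓝 x, ∀ j ∈ Iio N, ∀ v, nrm (g ((⇑g)^[j] y))
      (Cinv (g ((⇑g)^[j] x)) (g ((⇑g)^[j] y)) (B j (C ((⇑g)^[j] x) ((⇑g)^[j] y) v)) -
        D g ((⇑g)^[j] y) v) ≤ ε₁ * nrm ((⇑g)^[j] y) v := by
    refine (eventually_all_finite (finite_Iio N)).2 fun j hj ↦ (hcont j).eventually
      (eventually_nrm_conj_sub_le g ((⇑g)^[j] x) (ε := ε₁ / 2) (by linarith) fun v ↦ ?_)
    rw [hit j (le_of_lt hj), (hg' j hj).1, (hg' j hj).2]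
    have e1 := hB j hj v
    have e2 := hηD ((⇑f)^[j] x) v
    rw [Function.iterate_succ_apply'] at e1
    have e3 : B j v - ((1 + η) • D f ((⇑f)^[j] x)) v = (B j v - D f ((⇑f)^[j] x) v) -
        ((1 + η) • D f ((⇑f)^[j] x) v - D f ((⇑f)^[j] x) v) := by
      rw [smul_apply]; abel
    rw [e3]
    have e4 : η * K * nrm ((⇑f)^[j] x) v ≤ ε₁ / 4 * nrm ((⇑f)^[j] x) v :=
      mul_le_mul_of_nonneg_right (hη.le.trans (min_le_right _ _)) (nrm_nonneg _ _)
    have e5 := nrm_sub (f ((⇑f)^[j] x)) (B j v - D f ((⇑f)^[j] x) v)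
      ((1 + η) • D f ((⇑f)^[j] x) v - D f ((⇑f)^[j] x) v)
    linarith
  have hsrc : ∀ᶠ y in 𝓝 x, ∀ j ∈ Iic N, (⇑g)^[j] y ∈ src (d := d) ((⇑g)^[j] x) :=
    (eventually_all_finite (finite_Iic N)).2 fun j _ ↦ (hcont j).eventually (src_mem_nhds _)
  obtain ⟨y, hinj, hcl, hys⟩ := (hfreq.and_eventually (hclose.and hsrc)).exists
  -- the cocycle `B` is transported to this segment, on which it is a function of the point
  set ind : M → ℕ := Function.invFunOn (fun j : ℕ ↦ (⇑g)^[j] y) (Iio N) with hind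
  have hindj : ∀ j < N, ind ((⇑g)^[j] y) = j := fun j hj ↦ hinj.leftInvOn_invFunOn hj
  set B' : ℕ → EuclideanSpace ℝ (Fin d) →L[ℝ] EuclideanSpace ℝ (Fin d) := fun j ↦
    (Cinv ((⇑g)^[j + 1] x) ((⇑g)^[j + 1] y)).comp ((B j).comp (C ((⇑g)^[j] x) ((⇑g)^[j] y)))
    with hB'
  obtain ⟨k, hkU, hk⟩ := h₁ g hgU ((Finset.range N).image fun j ↦ (⇑g)^[j] y)
    (fun z ↦ B' (ind z)) (by
      intro p hp v
      obtain ⟨j, hj, rfl⟩ := Finset.mem_image.1 hp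
      rw [Finset.mem_range] at hj
      rw [hindj j hj]
      simpa only [hB', ContinuousLinearMap.comp_apply, Function.iterate_succ_apply']
        using hcl j hj v)
  have hk' : ∀ j < N, k ((⇑g)^[j] y) = g ((⇑g)^[j] y) ∧ D k ((⇑g)^[j] y) = B' j := fun j hj ↦ by
    have := hk _ (Finset.mem_image_of_mem _ (Finset.mem_range.2 hj))
    rwa [hindj j hj] at this
  have hkit : ∀ j ≤ N, (⇑k)^[j] y = (⇑g)^[j] y := fun j hj ↦
    iterate_congr (fun j hj ↦ (hk' j hj).1) hj
  have hconj : ∀ n ≤ N, iterD k n y =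
      (Cinv ((⇑g)^[n] x) ((⇑g)^[n] y)).comp ((cprod B n).comp (C x y)) := by
    intro n hn
    induction n with
    | zero =>
      ext1 v
      rw [iterD_zero]
      exact (Cinv_C (hys 0 hn) v).symm
    | succ n ih =>
      rw [iterD_succ, hkit n (by omega), (hk' n (by omega)).2, ih (by omega)]
      ext1 v
      simp only [hB', cprod, ContinuousLinearMap.comp_apply]
      rw [C_Cinv (hys n (by simp; omega))]
  refine ⟨k, hkU, y, ?_⟩
  have hCi : Function.Injective (Cinv (d := d) x y) :=
    Function.LeftInverse.injective (g := C x y) (C_Cinv (hys 0 (by simp)))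
  have hker : ∀ v ∈ LinearMap.ker (cprod B N).toLinearMap,
      (Cinv (d := d) x y).toLinearMap v ∈ LinearMap.ker (iterD k N y).toLinearMap := by
    intro v hv
    have hv' : cprod B N v = 0 := hv
    change iterD k N y (Cinv x y v) = 0
    rw [hconj N le_rfl, ContinuousLinearMap.comp_apply, ContinuousLinearMap.comp_apply]
    have : C x y (Cinv x y v) = v := C_Cinv (hys 0 (by simp)) v
    rw [this, hv', map_zero]
  rw [kerDim_eq]
  exact LinearMap.finrank_le_finrank_of_injective (f := LinearMap.restrict _ hker)
    fun v w hvw ↦ Subtype.ext (hCi (congrArg Subtype.val hvw))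

end OrbitSegments

/-! ### The subspaces `E` and `F` along an orbit -/

section LimitBundles

variable {κ : ℕ} {f : End1 d M} {x : ℤ → M}

lemma iterate_orbit (hx : x ∈ orbits f) (i : ℤ) (n : ℕ) : (⇑f)^[n] (x i) = x (i + n) := by
  induction n with
  | zero => simp
  | succ n ih =>
    rw [Function.iterate_succ_apply', ih, hx]
    congr 1
    push_cast
    ring

lemma iterate_orbit_sub (hx : x ∈ orbits f) (i : ℤ) (n : ℕ) : (⇑f)^[n] (x (i - n)) = x i := by
  rw [iterate_orbit hx, sub_add_cancel]

lemma kerDim_zero (f : End1 d M) (x : M) : kerDim f 0 x = 0 := by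
  rw [kerDim_eq, iterD_zero]
  change Module.finrank ℝ (LinearMap.ker (LinearMap.id : EuclideanSpace ℝ (Fin d) →ₗ[ℝ] _)) = 0
  rw [LinearMap.ker_id, finrank_bot]

lemma kerDim_le_add (f : End1 d M) (m n : ℕ) (y : M) : kerDim f n y ≤ kerDim f (m + n) y := by
  rw [kerDim_eq, kerDim_eq, iterD_add]
  exact Submodule.finrank_mono (LinearMap.ker_le_ker_comp _ _)

lemma kerDim_add_finrank_range (f : End1 d M) (n : ℕ) (y : M) :
    kerDim f n y + Module.finrank ℝ (LinearMap.range (iterD f n y).toLinearMap) = d := by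
  have := LinearMap.finrank_range_add_finrank_ker (iterD f n y).toLinearMap
  rw [finrank_euclideanSpace_fin] at this
  rw [kerDim_eq]
  omega

lemma range_iterD_add_le (f : End1 d M) (m n : ℕ) (y : M) :
    LinearMap.range (iterD f (m + n) y).toLinearMap ≤
      LinearMap.range (iterD f m ((⇑f)^[n] y)).toLinearMap := by
  rw [iterD_add]
  exact LinearMap.range_comp_le_range _ _

lemma kerDim_iterate_le_add (f : End1 d M) (m n : ℕ) (y : M) :
    kerDim f m ((⇑f)^[n] y) ≤ kerDim f (m + n) y := by
  have h1 := kerDim_add_finrank_range f (m + n) y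
  have h2 := kerDim_add_finrank_range f m ((⇑f)^[n] y)
  have h3 := Submodule.finrank_mono (range_iterD_add_le f m n y)
  omega

/-- The subspace `E(x_i)`, as a subspace of the model space. -/
def Eb (κ : ℕ) (f : End1 d M) (x : ℤ → M) (i : ℤ) : Submodule ℝ (EuclideanSpace ℝ (Fin d)) :=
  kerBundle κ f x i

/-- The subspace `F(x_i)`, as a subspace of the model space. -/
def Fb (κ : ℕ) (f : End1 d M) (x : ℤ → M) (i : ℤ) : Submodule ℝ (EuclideanSpace ℝ (Fin d)) :=
  imBundle κ f x i

lemma exists_nat_mem_crit (hx : x ∈ Lam κ f) (i : ℤ) : ∃ n : ℕ, x (i + n) ∈ crit κ f := by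
  obtain ⟨-, -, h⟩ := hx
  by_contra hcon
  push Not at hcon
  refine h ((finite_Icc (0 : ℤ) i).subset ?_)
  rintro j ⟨hj0, hj⟩
  refine ⟨hj0.le, ?_⟩
  by_contra hij
  have := hcon (j - i).toNat
  rw [Int.toNat_of_nonneg (by omega), add_sub_cancel] at this
  exact this hj

lemma exists_nat_mem_crit_past (hx : x ∈ Lam κ f) (i : ℤ) (m : ℕ) :
    ∃ n : ℕ, m ≤ n ∧ x (i - n) ∈ crit κ f := by
  obtain ⟨-, h, -⟩ := hx
  by_contra hcon
  push Not at hcon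
  refine h ((finite_Icc (i - m) 0).subset ?_)
  rintro j ⟨hj0, hj⟩
  refine ⟨?_, hj0.le⟩
  by_contra hij
  have := hcon (i - j).toNat (by omega)
  rw [Int.toNat_of_nonneg (by omega), sub_sub_cancel] at this
  exact this hj

section

variable (hk : ∀ m y, kerDim f m y ≤ κ) (hx : x ∈ Lam κ f)

include hk hx

/-- `E(x_i)` is the eventual kernel of the derivative cocycle. -/
lemma exists_Eb_eq (i : ℤ) : ∃ n₀ : ℕ, ∀ n ≥ n₀,
    Eb κ f x i = LinearMap.ker (iterD f n (x i)).toLinearMap ∧ kerDim f n (x i) = κ := by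
  have hτ : x (i + tauPlus κ f x i) ∈ crit κ f := Nat.sInf_mem (exists_nat_mem_crit hx i)
  have hdim : ∀ n ≥ order κ f + tauPlus κ f x i, kerDim f n (x i) = κ := by
    intro n hn
    refine le_antisymm (hk _ _) ?_
    obtain ⟨k, rfl⟩ := Nat.exists_eq_add_of_le' hn
    refine le_trans ?_ (kerDim_le_add f k _ _)
    refine le_trans (le_of_eq ?_) (kerDim_iterate_le_add f _ _ _)
    rw [iterate_orbit hx.1]
    exact hτ.symm
  refine ⟨order κ f + tauPlus κ f x i, fun n hn ↦ ⟨?_, hdim n hn⟩⟩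
  refine Submodule.eq_of_le_of_finrank_eq ?_ ((hdim _ le_rfl).trans (hdim n hn).symm)
  obtain ⟨k, rfl⟩ := Nat.exists_eq_add_of_le' hn
  rw [iterD_add]
  exact LinearMap.ker_le_ker_comp _ _

/-- `F(x_i)` is the eventual image of the derivative cocycle. -/
lemma exists_Fb_eq (i : ℤ) : ∃ n₀ : ℕ, ∀ n ≥ n₀,
    Fb κ f x i = LinearMap.range (iterD f n (x (i - n))).toLinearMap ∧
      kerDim f n (x (i - n)) = κ := by
  set σ := absTauMinus κ f x i with hσ
  obtain ⟨hσm, hσc⟩ : order κ f ≤ σ ∧ x (i - σ) ∈ crit κ f :=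
    Nat.sInf_mem (exists_nat_mem_crit_past hx i (order κ f))
  have hpt : ∀ k : ℕ, (⇑f)^[k] (x (i - ((σ + k : ℕ) : ℤ))) = x (i - σ) := fun k ↦ by
    rw [iterate_orbit hx.1]
    congr 1
    push_cast
    ring
  have hσκ : kerDim f σ (x (i - σ)) = κ := by
    refine le_antisymm (hk _ _) ?_
    obtain ⟨k, hk'⟩ := Nat.exists_eq_add_of_le' hσm
    have := kerDim_le_add f k (order κ f) (x (i - σ))
    rw [← hk'] at this
    exact le_trans (le_of_eq hσc.symm) this
  have hdim : ∀ n ≥ σ, kerDim f n (x (i - n)) = κ := by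
    intro n hn
    refine le_antisymm (hk _ _) ?_
    obtain ⟨k, rfl⟩ := Nat.exists_eq_add_of_le hn
    have := kerDim_iterate_le_add f σ k (x (i - ((σ + k : ℕ) : ℤ)))
    rwa [hpt, hσκ] at this
  refine ⟨σ, fun n hn ↦ ⟨?_, hdim n hn⟩⟩
  have h1 := kerDim_add_finrank_range f n (x (i - n))
  have h2 := kerDim_add_finrank_range f σ (x (i - σ))
  have h3 := hdim n hn
  refine (Submodule.eq_of_le_of_finrank_eq ?_ ?_).symm
  · obtain ⟨k, rfl⟩ := Nat.exists_eq_add_of_le hn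
    have := range_iterD_add_le f σ k (x (i - ((σ + k : ℕ) : ℤ)))
    rwa [hpt] at this
  · change _ = Module.finrank ℝ (LinearMap.range (iterD f σ (x (i - σ))).toLinearMap)
    omega

lemma finrank_Eb (i : ℤ) : Module.finrank ℝ (Eb κ f x i) = κ := by
  obtain ⟨n, hn⟩ := exists_Eb_eq hk hx i
  obtain ⟨h1, h2⟩ := hn n le_rfl
  rw [h1, ← kerDim_eq, h2]

lemma finrank_Fb (i : ℤ) : Module.finrank ℝ (Fb κ f x i) = d - κ := by
  obtain ⟨n, hn⟩ := exists_Fb_eq hk hx i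
  obtain ⟨h1, h2⟩ := hn n le_rfl
  have := kerDim_add_finrank_range f n (x (i - n))
  rw [h1]
  omega

lemma mem_Eb_of_iterD_eq_zero {i : ℤ} {n : ℕ} {v : EuclideanSpace ℝ (Fin d)}
    (hv : iterD f n (x i) v = 0) : v ∈ Eb κ f x i := by
  obtain ⟨n₀, hn⟩ := exists_Eb_eq hk hx i
  rw [(hn (n₀ + n) (by omega)).1]
  change iterD f (n₀ + n) (x i) v = 0
  rw [iterD_add, ContinuousLinearMap.comp_apply, hv, map_zero]

lemma disjoint_Eb_Fb (i : ℤ) : Disjoint (Eb κ f x i) (Fb κ f x i) := by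
  rw [Submodule.disjoint_def]
  intro v hvE hvF
  obtain ⟨n, hn⟩ := exists_Eb_eq hk hx i
  obtain ⟨m, hm⟩ := exists_Fb_eq hk hx i
  rw [(hn n le_rfl).1] at hvE
  rw [(hm m le_rfl).1] at hvF
  obtain ⟨w, rfl⟩ := hvF
  -- the kernel of the iterate cannot grow beyond dimension `κ`
  have hker : LinearMap.ker (iterD f m (x (i - m))).toLinearMap =
      LinearMap.ker (iterD f (n + m) (x (i - m))).toLinearMap := by
    refine Submodule.eq_of_le_of_finrank_le ?_ ?_
    · rw [iterD_add]
      exact LinearMap.ker_le_ker_comp _ _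
    · rw [← kerDim_eq, ← kerDim_eq, (hm m le_rfl).2]
      exact hk _ _
  have hw : w ∈ LinearMap.ker (iterD f (n + m) (x (i - m))).toLinearMap := by
    change iterD f (n + m) (x (i - m)) w = 0
    rw [iterD_add, iterate_orbit_sub hx.1]
    exact hvE
  rw [← hker] at hw
  exact hw

lemma isCompl_Eb_Fb (i : ℤ) : IsCompl (Eb κ f x i) (Fb κ f x i) := by
  have hd := disjoint_Eb_Fb hk hx i
  refine ⟨hd, codisjoint_iff.2 (Submodule.eq_top_of_disjoint _ _ ?_ hd)⟩
  rw [finrank_Eb hk hx, finrank_Fb hk hx, finrank_euclideanSpace_fin]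
  have := kerDim_add_finrank_range f (order κ f) (x (i + tauPlus κ f x i))
  have h2 : x (i + tauPlus κ f x i) ∈ crit κ f := Nat.sInf_mem (exists_nat_mem_crit hx i)
  have h3 : kerDim f (order κ f) (x (i + tauPlus κ f x i)) = κ := h2
  omega

lemma iterD_mem_Eb {i : ℤ} (m : ℕ) {u : EuclideanSpace ℝ (Fin d)} (hu : u ∈ Eb κ f x i) :
    iterD f m (x i) u ∈ Eb κ f x (i + m) := by
  obtain ⟨n, hn⟩ := exists_Eb_eq hk hx i
  refine mem_Eb_of_iterD_eq_zero hk hx (n := n) ?_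
  rw [(hn (n + m) (by omega)).1] at hu
  have hu' : iterD f (n + m) (x i) u = 0 := hu
  rwa [iterD_add, iterate_orbit hx.1] at hu'

lemma map_iterD_Fb (i : ℤ) (m : ℕ) :
    (Fb κ f x i).map (iterD f m (x i)).toLinearMap = Fb κ f x (i + m) := by
  obtain ⟨n, hn⟩ := exists_Fb_eq hk hx i
  obtain ⟨n', hn'⟩ := exists_Fb_eq hk hx (i + m)
  rw [(hn (n + n') (by omega)).1, (hn' (m + (n + n')) (by omega)).1, ← LinearMap.range_comp]
  have h1 : i + m - ((m + (n + n') : ℕ) : ℤ) = i - ((n + n' : ℕ) : ℤ) := by push_cast; ring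
  rw [h1, iterD_add f m (n + n') (x (i - ((n + n' : ℕ) : ℤ))), iterate_orbit_sub hx.1]
  rfl

lemma iterD_mem_Fb {i : ℤ} (m : ℕ) {v : EuclideanSpace ℝ (Fin d)} (hv : v ∈ Fb κ f x i) :
    iterD f m (x i) v ∈ Fb κ f x (i + m) := by
  rw [← map_iterD_Fb hk hx]
  exact Submodule.mem_map_of_mem hv

lemma iterD_ne_zero_of_mem_Fb {i : ℤ} (m : ℕ) {v : EuclideanSpace ℝ (Fin d)}
    (hv : v ∈ Fb κ f x i) (hv0 : v ≠ 0) : iterD f m (x i) v ≠ 0 := fun h ↦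
  hv0 (Submodule.disjoint_def.1 (disjoint_Eb_Fb hk hx i) v (mem_Eb_of_iterD_eq_zero hk hx h) hv)

end

lemma shift_preimage_Lam (κ : ℕ) (f : End1 d M) :
    (fun (x : ℤ → M) (i : ℤ) ↦ x (i + 1)) ⁻¹' Lam κ f = Lam κ f := by
  have key : ∀ S T : Set ℤ, (∀ i ∈ S, i - 1 ∈ T ∨ i = 1) → S.Infinite → T.Infinite := by
    intro S T hST hS hT
    refine hS (((hT.image (· + 1)).union (finite_singleton 1)).subset fun i hi ↦ ?_)
    rcases hST i hi with h | h
    · exact Or.inl ⟨i - 1, h, by simp⟩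
    · exact Or.inr h
  have key' : ∀ S T : Set ℤ, (∀ i ∈ S, i + 1 ∈ T ∨ i = -1) → S.Infinite → T.Infinite := by
    intro S T hST hS hT
    refine hS (((hT.image (· - 1)).union (finite_singleton (-1))).subset fun i hi ↦ ?_)
    rcases hST i hi with h | h
    · exact Or.inl ⟨i + 1, h, by simp⟩
    · exact Or.inr h
  ext x
  have horb : (fun i ↦ x (i + 1)) ∈ orbits f ↔ x ∈ orbits f := by
    constructor
    · intro h i
      have := h (i - 1)
      simpa using this
    · exact fun h i ↦ h (i + 1)
  refine and_congr horb (and_congr ⟨key' _ _ ?_, key _ _ ?_⟩ ⟨key' _ _ ?_, key _ _ ?_⟩)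
  · rintro i ⟨hi, hc⟩
    by_cases h : i = -1
    · exact Or.inr h
    · exact Or.inl ⟨by omega, hc⟩
  · rintro i ⟨hi, hc⟩
    exact Or.inl ⟨by omega, by simpa using hc⟩
  · rintro i ⟨hi, hc⟩
    exact Or.inl ⟨by omega, hc⟩
  · rintro i ⟨hi, hc⟩
    by_cases h : i = 1
    · exact Or.inr h
    · exact Or.inl ⟨by omega, by simpa using hc⟩

end LimitBundles

/-! ### Pseudo-orbits of the derivative cocycle and domination -/

section Domination

/-- The chord between two directions is no longer than the arc. -/
lemma norm_inv_smul_sub_le_angle {V : Type*} [NormedAddCommGroup V] [InnerProductSpace ℝ V]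
    {u v : V} (hu : u ≠ 0) (hv : v ≠ 0) :
    ‖‖u‖⁻¹ • u - ‖v‖⁻¹ • v‖ ≤ InnerProductGeometry.angle u v := by
  have h2 :=
    InnerProductGeometry.norm_sub_sq_eq_norm_sq_add_norm_sq_sub_two_mul_norm_mul_norm_mul_cos_angle
      (‖u‖⁻¹ • u) (‖v‖⁻¹ • v)
  rw [InnerProductGeometry.angle_smul_left_of_pos _ _ (inv_pos.2 (norm_pos_iff.2 hu)),
    InnerProductGeometry.angle_smul_right_of_pos _ _ (inv_pos.2 (norm_pos_iff.2 hv)),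
    norm_smul, norm_smul, norm_inv, norm_inv, norm_norm, norm_norm,
    inv_mul_cancel₀ (norm_ne_zero_iff.2 hu), inv_mul_cancel₀ (norm_ne_zero_iff.2 hv)] at h2
  have h4 := Real.one_sub_sq_div_two_le_cos (x := InnerProductGeometry.angle u v)
  refine (abs_le_of_sq_le_sq' ?_ (InnerProductGeometry.angle_nonneg _ _)).2
  nlinarith

variable [Bundle.RiemannianBundle (fun x : M ↦ TangentSpace (𝓡 d) x)]

/-- Every `ε`-perturbation of the derivative cocycle of `f` along a finite orbit segment has a
kernel of dimension at most `κ`. -/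
def KernelRobust (κ : ℕ) (ε : ℝ) (f : End1 d M) : Prop :=
  ∀ (x : M) (N : ℕ) (B : ℕ → EuclideanSpace ℝ (Fin d) →L[ℝ] EuclideanSpace ℝ (Fin d)),
    (∀ j < N, ∀ v, nrm ((⇑f)^[j + 1] x) (B j v - D f ((⇑f)^[j] x) v) ≤
      ε * nrm ((⇑f)^[j] x) v) →
    Module.finrank ℝ (LinearMap.ker (cprod B N).toLinearMap) ≤ κ

variable {κ : ℕ} {f : End1 d M} {x : ℤ → M} {ε K : ℝ}

lemma KernelRobust.kerDim_le (hR : KernelRobust κ ε f) (hε : 0 ≤ ε) (m : ℕ) (y : M) :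
    kerDim f m y ≤ κ := by
  rw [kerDim_eq, iterD_eq_cprod]
  refine hR y m _ fun j _ v ↦ ?_
  rw [sub_self, nrm_zero]
  exact mul_nonneg hε (nrm_nonneg _ _)

/-- The rank one correction sending `w` to `δ` is no larger than the ratio of their norms. -/
lemma nrm_rankOne_le {p q : M} {w δ : EuclideanSpace ℝ (Fin d)} (hw : w ≠ 0)
    (h : nrm q δ ≤ ε * nrm p w) (v : EuclideanSpace ℝ (Fin d)) :
    nrm q (((nrm p w ^ 2)⁻¹ * ip p w v) • δ) ≤ ε * nrm p v := by
  have h0 : 0 < nrm p w := nrm_pos p hw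
  rw [nrm_smul, abs_mul, abs_of_pos (by positivity)]
  have hv := nrm_nonneg p v
  have hδ := nrm_nonneg q δ
  calc (nrm p w ^ 2)⁻¹ * |ip p w v| * nrm q δ
      ≤ (nrm p w ^ 2)⁻¹ * (nrm p w * nrm p v) * (ε * nrm p w) :=
        mul_le_mul (mul_le_mul_of_nonneg_left (abs_ip_le p w v) (by positivity)) h hδ
          (by positivity)
    _ = ε * nrm p v := by field_simp

/-- The derivative cocycle of `f` has no `ε`-pseudo-orbit leading from `F` into `E`: otherwise, a
perturbation of the cocycle would send one more direction, besides the kernel of a long past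
iterate, into the kernel of a long future iterate. -/
lemma not_pseudoOrbit (hR : KernelRobust κ ε f) (hε : 0 ≤ ε) (hx : x ∈ Lam κ f) {i : ℤ} {n : ℕ}
    (hn : 0 < n) {w : ℕ → EuclideanSpace ℝ (Fin d)} (hw0 : w 0 ∈ Fb κ f x i)
    (hwn : w n ∈ Eb κ f x (i + n)) (hne : ∀ j < n, w j ≠ 0)
    (hstep : ∀ j < n, nrm (x (i + (j + 1 : ℕ))) (w (j + 1) - D f (x (i + j)) (w j)) ≤
      ε * nrm (x (i + j)) (w j)) : False := by
  have hk := hR.kerDim_le hε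
  obtain ⟨N, hN⟩ := exists_Fb_eq hk hx i
  obtain ⟨k, hk'⟩ := exists_Eb_eq hk hx (i + n)
  obtain ⟨hF, hdim⟩ := hN N le_rfl
  have hE := (hk' k le_rfl).1
  rw [hF] at hw0
  rw [hE] at hwn
  obtain ⟨a, ha⟩ := hw0
  set y := x (i - N) with hy
  have hpt : ∀ j : ℕ, (⇑f)^[N + j] y = x (i + j) := fun j ↦ by
    rw [iterate_orbit hx.1]
    congr 1
    push_cast
    ring
  let φ : ℕ → EuclideanSpace ℝ (Fin d) →L[ℝ] ℝ := fun j ↦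
    (nrm (x (i + j)) (w j) ^ 2)⁻¹ • ip (x (i + j)) (w j)
  have hφ : ∀ j < n, φ j (w j) = 1 := fun j hj ↦ by
    have h0 : 0 < nrm (x (i + j)) (w j) := nrm_pos _ (hne j hj)
    change (nrm (x (i + j)) (w j) ^ 2)⁻¹ * ip (x (i + j)) (w j) (w j) = 1
    rw [ip_self]
    field_simp
  let δ : ℕ → EuclideanSpace ℝ (Fin d) := fun j ↦ w (j + 1) - D f (x (i + j)) (w j)
  let B : ℕ → EuclideanSpace ℝ (Fin d) →L[ℝ] EuclideanSpace ℝ (Fin d) := fun m ↦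
    D f ((⇑f)^[m] y) + if N ≤ m ∧ m < N + n then (φ (m - N)).smulRight (δ (m - N)) else 0
  have hBout : ∀ m, ¬ (N ≤ m ∧ m < N + n) → B m = D f ((⇑f)^[m] y) := fun m hm ↦ by
    simp only [B, if_neg hm, add_zero]
  have hBin : ∀ j < n, ∀ v, B (N + j) v = D f (x (i + j)) v + φ j v • δ j := fun j hj v ↦ by
    have : N ≤ N + j ∧ N + j < N + n := ⟨by omega, by omega⟩
    simp only [B, if_pos this, hpt, Nat.add_sub_cancel_left]
    rfl
  have hsmall : ∀ m < N + n + k, ∀ v, nrm ((⇑f)^[m + 1] y) (B m v - D f ((⇑f)^[m] y) v) ≤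
      ε * nrm ((⇑f)^[m] y) v := by
    intro m _ v
    by_cases hm : N ≤ m ∧ m < N + n
    · obtain ⟨j, rfl⟩ := Nat.exists_eq_add_of_le hm.1
      have hj : j < n := by omega
      rw [hBin j hj, add_assoc N j 1, hpt, hpt, add_sub_cancel_left]
      exact nrm_rankOne_le (hne j hj) (hstep j hj) v
    · rw [hBout m hm, sub_self, nrm_zero]
      exact mul_nonneg hε (nrm_nonneg _ _)
  have hpast : cprod B N = iterD f N y := by
    rw [iterD_eq_cprod]
    exact cprod_congr fun m hm ↦ hBout m (by omega)
  have hpath : ∀ j ≤ n, cprod B (N + j) a = w j := by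
    intro j
    induction j with
    | zero => exact fun _ ↦ by rw [add_zero, hpast]; exact ha
    | succ j ih =>
      intro hj
      rw [← add_assoc, cprod, ContinuousLinearMap.comp_apply, ih (by omega), hBin j (by omega),
        hφ j (by omega), one_smul, add_sub_cancel]
  have hfut : cprod (fun j ↦ B (N + n + j)) k = iterD f k (x (i + n)) := by
    rw [iterD_eq_cprod]
    refine cprod_congr fun j _ ↦ ?_
    rw [hBout _ (by omega), ← hpt n, ← Function.iterate_add_apply, add_comm j]
  have hlt : LinearMap.ker (iterD f N y).toLinearMap <
      LinearMap.ker (cprod B (N + n + k)).toLinearMap := by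
    refine SetLike.lt_iff_le_and_exists.2 ⟨?_, a, ?_, ?_⟩
    · rw [add_assoc, cprod_add, hpast]
      exact LinearMap.ker_le_ker_comp _ _
    · change cprod B (N + n + k) a = 0
      rw [cprod_add, ContinuousLinearMap.comp_apply, hpath n le_rfl, hfut]
      exact hwn
    · intro h
      have h' : iterD f N y a = 0 := h
      rw [← hpast] at h'
      exact hne 0 hn ((hpath 0 n.zero_le).symm.trans h')
  have h1 := Submodule.finrank_lt_finrank_of_lt hlt
  rw [← kerDim_eq, hdim] at h1
  exact absurd (hR y _ B hsmall) (not_le.2 h1)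

section

variable (hR : KernelRobust κ ε f) (hε : 0 < ε)
  (hK : ∀ (y : M) (v : EuclideanSpace ℝ (Fin d)), nrm (f y) (D f y v) ≤ K * nrm y v)
  (hx : x ∈ Lam κ f)

include hR hε hK hx

/-- Vectors of `F` are not close to `E`: otherwise, a single small correction would move the image
of one of them into `E`. -/
lemma mul_nrm_right_le_nrm_add {i : ℤ} {u v : EuclideanSpace ℝ (Fin d)} (hu : u ∈ Eb κ f x i)
    (hv : v ∈ Fb κ f x i) : ε * nrm (x i) v ≤ K * nrm (x i) (u + v) := by
  have hk := hR.kerDim_le hε.le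
  by_cases hv0 : v = 0
  · subst hv0
    rw [nrm_zero, mul_zero]
    exact (nrm_nonneg _ _).trans (hK _ _)
  by_contra! hlt
  refine not_pseudoOrbit hR hε.le hx one_pos (i := i)
    (w := fun j ↦ if j = 0 then v else -D f (x i) u) (by simpa using hv) ?_ ?_ ?_
  · have := iterD_mem_Eb hk hx 1 hu
    rw [iterD_one] at this
    simpa using this
  · intro j hj
    obtain rfl : j = 0 := by omega
    simpa using hv0
  · intro j hj
    obtain rfl : j = 0 := by omega
    have h := hK (x i) (u + v)
    rw [hx.1 i] at h
    have e : -D f (x i) u - D f (x i) v = -D f (x i) (u + v) := by rw [map_add]; abel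
    simp only [zero_add, Nat.cast_one, Nat.cast_zero, add_zero, if_true, one_ne_zero, if_false, e,
      nrm_neg]
    exact h.trans hlt.le

lemma mul_nrm_left_le_nrm_add {i : ℤ} {u v : EuclideanSpace ℝ (Fin d)} (hu : u ∈ Eb κ f x i)
    (hv : v ∈ Fb κ f x i) : ε * nrm (x i) u ≤ (K + ε) * nrm (x i) (u + v) := by
  have h1 := mul_nrm_right_le_nrm_add hR hε hK hx hu hv
  have h2 : nrm (x i) u ≤ nrm (x i) (u + v) + nrm (x i) v := by
    simpa using nrm_sub (x i) (u + v) v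
  nlinarith

/-- The angle between `E` and `F` is at least the distance of the unit vectors. -/
lemma le_angle (hK0 : 0 < K) {i : ℤ} {u v : EuclideanSpace ℝ (Fin d)} (hu : u ∈ Eb κ f x i)
    (hv : v ∈ Fb κ f x i) (hu0 : u ≠ 0) (hv0 : v ≠ 0) :
    ε / K ≤ InnerProductGeometry.angle (V := TangentSpace (𝓡 d) (x i)) u v := by
  refine le_trans ?_ (norm_inv_smul_sub_le_angle (V := TangentSpace (𝓡 d) (x i)) hu0 hv0)
  have hnv := nrm_pos (x i) hv0
  have h1 := mul_nrm_right_le_nrm_add hR hε hK hx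
    (Submodule.smul_mem _ (nrm (x i) u)⁻¹ hu) (Submodule.smul_mem _ (-(nrm (x i) v)⁻¹) hv)
  rw [nrm_smul, abs_neg, abs_of_pos (inv_pos.2 hnv), inv_mul_cancel₀ hnv.ne', mul_one,
    ← div_le_iff₀' hK0, neg_smul, ← sub_eq_add_neg] at h1
  exact h1

/-- Vectors of `E` are dominated by vectors of `F` after `k + 1` iterations: otherwise, adding to
the orbit of a vector of `F` a slowly growing multiple of the orbit of a vector of `E` gives a
pseudo-orbit which ends in `E`. -/
lemma nrm_iterD_le (hK0 : 0 < K) {k : ℕ} {s : ℝ} (hs : s * (K * (K + ε)) = ε ^ 2)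
    (hk2 : 2 * K * (K + ε) ≤ ε ^ 2 * (s * (1 + s) ^ k)) {i : ℤ} {u v : EuclideanSpace ℝ (Fin d)}
    (hu : u ∈ Eb κ f x i) (hv : v ∈ Fb κ f x i) (hu1 : nrm (x i) u = 1) (hv1 : nrm (x i) v = 1) :
    nrm (x (i + (k + 1 : ℕ))) (iterD f (k + 1) (x i) u) ≤
      1 / 2 * nrm (x (i + (k + 1 : ℕ))) (iterD f (k + 1) (x i) v) := by
  have hkd := hR.kerDim_le hε.le
  by_contra! hlt
  have hs0 : 0 < s := pos_of_mul_pos_left (by rw [hs]; positivity) (by positivity)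
  have hKε : 0 < K + ε := by positivity
  have hsK : s * K * (K + ε) = ε ^ 2 := by rw [← hs]; ring
  have hv0 : v ≠ 0 := by
    rintro rfl
    rw [nrm_zero] at hv1
    exact zero_ne_one hv1
  set U : ℕ → EuclideanSpace ℝ (Fin d) := fun j ↦ iterD f j (x i) u with hU
  set V : ℕ → EuclideanSpace ℝ (Fin d) := fun j ↦ iterD f j (x i) v with hV
  have hUE : ∀ j : ℕ, U j ∈ Eb κ f x (i + j) := fun j ↦ iterD_mem_Eb hkd hx j hu
  have hVF : ∀ j : ℕ, V j ∈ Fb κ f x (i + j) := fun j ↦ iterD_mem_Fb hkd hx j hv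
  have hV0 : ∀ j : ℕ, V j ≠ 0 := fun j ↦ iterD_ne_zero_of_mem_Fb hkd hx j hv hv0
  have hDs : ∀ (j : ℕ) z, D f (x (i + j)) (iterD f j (x i) z) = iterD f (j + 1) (x i) z := by
    intro j z
    rw [iterD_succ, iterate_orbit hx.1]
    rfl
  have hDU : ∀ j : ℕ, D f (x (i + j)) (U j) = U (j + 1) := fun j ↦ hDs j u
  have hDV : ∀ j : ℕ, D f (x (i + j)) (V j) = V (j + 1) := fun j ↦ hDs j v
  have hKs : ∀ (j : ℕ) z, nrm (x (i + (j + 1 : ℕ))) (D f (x (i + j)) z) ≤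
      K * nrm (x (i + j)) z := by
    intro j z
    have h := hK (x (i + j)) z
    rw [hx.1] at h
    push_cast
    rwa [← add_assoc]
  -- the multiple `c j` grows by the factor `1 + s` at each step, up to a size at which dropping
  -- the component in `F` is a small correction
  set c : ℕ → ℝ := fun j ↦ if j = 0 then 0 else s * (1 + s) ^ (j - 1) with hc
  have hc0 : c 0 = 0 := if_pos rfl
  have hcs : ∀ j, c (j + 1) = s * (1 + s) ^ j := fun j ↦ by simp [hc]
  have hcpos : ∀ j, 0 ≤ c j := fun j ↦ by
    cases j with
    | zero => exact hc0.ge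
    | succ j => rw [hcs]; positivity
  have hEF : ∀ j : ℕ, ε * (c j * nrm (x (i + j)) (U j)) ≤
      (K + ε) * nrm (x (i + j)) (V j + c j • U j) := fun j ↦ by
    have h := mul_nrm_left_le_nrm_add hR hε hK hx (Submodule.smul_mem _ (c j) (hUE j)) (hVF j)
    rwa [nrm_smul, abs_of_nonneg (hcpos j), add_comm (c j • U j)] at h
  have hne : ∀ j : ℕ, V j + c j • U j ≠ 0 := fun j h0 ↦ by
    have h := mul_nrm_right_le_nrm_add hR hε hK hx (Submodule.smul_mem _ (c j) (hUE j)) (hVF j)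
    rw [add_comm (c j • U j), h0, nrm_zero, mul_zero] at h
    have := mul_pos hε (nrm_pos (x (i + j)) (hV0 j))
    linarith
  refine not_pseudoOrbit hR hε.le hx (i := i) (n := k + 2) (by omega)
    (w := fun j ↦ if j ≤ k + 1 then V j + c j • U j else c (k + 1) • U j) ?_ ?_ ?_ ?_
  · have := hVF 0
    simpa [hc0] using this
  · rw [if_neg (by omega)]
    exact Submodule.smul_mem _ _ (hUE _)
  · intro j hj
    rw [if_pos (by omega)]
    exact hne j
  · intro j hj
    rw [if_pos (show j ≤ k + 1 by omega)]
    rcases Nat.lt_or_ge j (k + 1) with hjk | hjk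
    · rw [if_pos (by omega)]
      have e : V (j + 1) + c (j + 1) • U (j + 1) - D f (x (i + j)) (V j + c j • U j) =
          (c (j + 1) - c j) • D f (x (i + j)) (U j) := by
        rw [map_add, map_smul, hDU, hDV, sub_smul]
        abel
      rw [e, nrm_smul]
      have hU1 := hKs j (U j)
      cases j with
      | zero =>
        have e0 : nrm (x (i + (0 : ℕ))) (V 0 + c 0 • U 0) = 1 := by
          simpa [hc0, hV, iterD_zero] using hv1
        have e1 : nrm (x (i + (0 : ℕ))) (U 0) = 1 := by
          simpa [hU, iterD_zero] using hu1
        rw [e0]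
        rw [e1] at hU1
        rw [hcs, hc0, pow_zero, mul_one, sub_zero, abs_of_pos hs0]
        have h1 : s * K ≤ ε := by
          refine le_of_mul_le_mul_right ?_ hKε
          rw [hsK]
          nlinarith
        calc s * _ ≤ s * (K * 1) := mul_le_mul_of_nonneg_left hU1 hs0.le
          _ ≤ ε * 1 := by linarith
      | succ j =>
        have e2 : c (j + 1 + 1) - c (j + 1) = s * c (j + 1) := by
          rw [hcs, hcs, pow_succ]
          ring
        have hcp := hcpos (j + 1)
        rw [e2, abs_of_nonneg (by positivity)]
        refine le_of_mul_le_mul_right ?_ hKε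
        calc s * c (j + 1) * _ * (K + ε)
            ≤ s * c (j + 1) * (K * nrm (x (i + (j + 1 : ℕ))) (U (j + 1))) * (K + ε) := by
              gcongr
          _ = ε * (ε * (c (j + 1) * nrm (x (i + (j + 1 : ℕ))) (U (j + 1)))) := by
              linear_combination c (j + 1) * nrm (x (i + (j + 1 : ℕ))) (U (j + 1)) * hsK
          _ ≤ ε * ((K + ε) * nrm (x (i + (j + 1 : ℕ))) (V (j + 1) + c (j + 1) • U (j + 1))) :=
              mul_le_mul_of_nonneg_left (hEF (j + 1)) hε.le
          _ = _ := by ring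
    · obtain rfl : j = k + 1 := by omega
      rw [if_neg (by omega)]
      have e : c (k + 1) • U (k + 1 + 1) -
          D f (x (i + (k + 1 : ℕ))) (V (k + 1) + c (k + 1) • U (k + 1)) =
          -D f (x (i + (k + 1 : ℕ))) (V (k + 1)) := by
        rw [map_add, map_smul, hDU]
        abel
      rw [e, nrm_neg]
      have hV1 := hKs (k + 1) (V (k + 1))
      have hEF1 := hEF (k + 1)
      refine hV1.trans (le_of_mul_le_mul_right ?_ hKε)
      have hlt' : nrm (x (i + (k + 1 : ℕ))) (V (k + 1)) ≤
          2 * nrm (x (i + (k + 1 : ℕ))) (U (k + 1)) := by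
        linarith
      have hnU := nrm_nonneg (x (i + (k + 1 : ℕ))) (U (k + 1))
      calc K * nrm (x (i + (k + 1 : ℕ))) (V (k + 1)) * (K + ε)
          ≤ K * (2 * nrm (x (i + (k + 1 : ℕ))) (U (k + 1))) * (K + ε) := by gcongr
        _ = 2 * K * (K + ε) * nrm (x (i + (k + 1 : ℕ))) (U (k + 1)) := by ring
        _ ≤ ε ^ 2 * c (k + 1) * nrm (x (i + (k + 1 : ℕ))) (U (k + 1)) := by
            rw [hcs]
            gcongr
        _ = ε * (ε * (c (k + 1) * nrm (x (i + (k + 1 : ℕ))) (U (k + 1)))) := by ring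
        _ ≤ ε * ((K + ε) * nrm (x (i + (k + 1 : ℕ))) (V (k + 1) + c (k + 1) • U (k + 1))) :=
            mul_le_mul_of_nonneg_left hEF1 hε.le
        _ = _ := by ring

end

end Domination

section

variable [Bundle.RiemannianBundle (fun x : M ↦ TangentSpace (𝓡 d) x)]

/-- For a kernel-robust map the splitting is dominated, with constants which only depend on the
size `ε` of the admissible perturbations and a bound `K` of the derivative. -/
lemma KernelRobust.isDominatedSplitting {κ : ℕ} {f : End1 d M} {ε K s : ℝ} {k : ℕ}
    (hR : KernelRobust κ ε f) (hε : 0 < ε) (hK0 : 0 < K)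
    (hK : ∀ (y : M) (v : EuclideanSpace ℝ (Fin d)), nrm (f y) (D f y v) ≤ K * nrm y v)
    (hs : s * (K * (K + ε)) = ε ^ 2) (hk : 2 * K * (K + ε) ≤ ε ^ 2 * (s * (1 + s) ^ k)) :
    IsDominatedSplitting κ f (Lam κ f) (kerBundle κ f) (imBundle κ f) (ε / K) (k + 1) := by
  have hker := hR.kerDim_le hε.le
  refine
    { subset_orbits := fun x hx ↦ hx.1
      invariant := shift_preimage_Lam κ f
      finrank_E := fun x hx i ↦ finrank_Eb hker hx i
      finrank_F := fun x hx i ↦ finrank_Fb hker hx i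
      isCompl := fun x hx i ↦ isCompl_Eb_Fb hker hx i
      map_E := fun x hx i u hu ↦ iterD_mem_Eb hker hx 1 hu
      map_F := fun x hx i ↦ map_iterD_Fb hker hx i 1
      angle_pos := div_pos hε hK0
      angle_le := fun x hx i u hu v hv hu0 hv0 ↦ le_angle hR hε hK hx hK0 hu hv hu0 hv0
      one_le := by omega
      dominated := fun x hx i u hu v hv hu1 hv1 ↦ ?_ }
  have h := nrm_iterD_le hR hε hK hx hK0 hs hk hu hv hu1 hv1
  rw [← iterate_orbit hx.1 i (k + 1)] at h
  exact h

end

end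

end EndoDom

theorem theoremB (d : ℕ) {M : Type*} [TopologicalSpace M] [T2Space M] [CompactSpace M]
    [ChartedSpace (EuclideanSpace ℝ (Fin d)) M] [IsManifold (𝓡 d) ∞ M]
    [Bundle.RiemannianBundle (fun x : M ↦ TangentSpace (𝓡 d) x)]
    [IsContMDiffRiemannianBundle (𝓡 d) ∞ (EuclideanSpace ℝ (Fin d))
      (fun x : M ↦ TangentSpace (𝓡 d) x)]
    (f₀ : EndoDom.End1 d M) (hcrit : ∃ x, EndoDom.IsCritical f₀ x)
    (κ : ℕ) (hκ : 1 ≤ κ) (hκd : κ < d)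
    (𝓕 : Set (EndoDom.End1 d M)) (hacc : f₀ ∈ closure 𝓕)
    (hΛ : ∀ f ∈ 𝓕, (EndoDom.Lam κ f).Nonempty)
    (hker : ∀ f ∈ 𝓕, ∀ m : ℕ, 1 ≤ m → ∀ x : M, EndoDom.kerDim f m x ≤ κ) :
    (∃ U ∈ 𝓝 f₀, ∃ ℓ : ℕ, ∃ α : ℝ, 0 < ℓ ∧ 0 < α ∧ ∀ f ∈ 𝓕 ∩ U,
      EndoDom.IsDominatedSplitting κ f (EndoDom.Lam κ f)
        (EndoDom.kerBundle κ f) (EndoDom.imBundle κ f) α ℓ) ∨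
    f₀ ∈ closure {g : EndoDom.End1 d M | ∃ m : ℕ, 1 ≤ m ∧ ∃ x : M, κ < EndoDom.kerDim g m x} := by
  by_cases hcl : f₀ ∈ closure {g : EndoDom.End1 d M | ∃ m : ℕ, 1 ≤ m ∧ ∃ x : M,
      κ < EndoDom.kerDim g m x}
  · exact Or.inr hcl
  refine Or.inl ?_
  have hU := isClosed_closure.isOpen_compl.mem_nhds hcl
  obtain ⟨U', hU', ε, hε, hfr⟩ := EndoDom.exists_franks_orbit f₀ hU
  obtain ⟨K, hK1, hK⟩ := EndoDom.exists_eventually_nrm_D_le f₀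
  have hK0 : 0 < K := by linarith
  set s := ε ^ 2 / (K * (K + ε)) with hs
  have hs0 : 0 < s := by positivity
  obtain ⟨k, hk⟩ := pow_unbounded_of_one_lt (2 * K * (K + ε) / (ε ^ 2 * s))
    (by linarith : 1 < 1 + s)
  rw [div_lt_iff₀' (by positivity), mul_assoc (ε ^ 2)] at hk
  refine ⟨_, Filter.inter_mem hU' hK, k + 1, ε / K, k.succ_pos, by positivity, ?_⟩
  rintro f ⟨hf, hfU, hfK⟩
  refine EndoDom.KernelRobust.isDominatedSplitting (fun x N B hB ↦ ?_) hε hK0 hfK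
    (div_mul_cancel₀ _ (by positivity)) hk.le
  -- no iterate has derivative zero, because the kernels have dimension at most `κ < d`
  have hne : ∀ i < N, EndoDom.iterD f i x ≠ 0 := by
    intro i _ h0
    have h1 := EndoDom.kerDim_add_finrank_range f i x
    rw [h0, ContinuousLinearMap.toLinearMap_zero, LinearMap.range_zero, finrank_bot] at h1
    rcases Nat.eq_zero_or_pos i with rfl | hi
    · rw [EndoDom.kerDim_zero] at h1
      omega
    · have := hker f hf i hi x
      omega
  obtain ⟨g, hg, y, hgy⟩ := hfr f hfU x N B hne hB
  refine hgy.trans ?_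
  by_contra! hlt
  refine hg (subset_closure ⟨N, Nat.one_le_iff_ne_zero.2 ?_, y, hlt⟩)
  rintro rfl
  rw [EndoDom.kerDim_zero] at hlt
  omega
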